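/- **Setting.** Let $L\ge 0$ be the number of links, $Q\ge 1$ the number of relay clusters, and let $H_0^l$ (source of link $l$ to cluster $1$), $H_q$, $1\le q<Q$ (cluster $q$ to cluster $q+1$), $H_Q^l$ (cluster $Q$ to destination of link $l$) be complex channel matrices. Let $\Phi=(\phi_{l,k})\in\{0,1\}^{L\times L}$ with $\phi_{l,l}=0$; let $W_q,\hat W_q$ (clusters) and $\hat W_0^l$ (sources) be positive semidefinite, $W_{Q+1}^l$ (destinations) positive definite, and $w_l\ge 0$. The relay precoders are $F=(F_1,\dots,F_Q)$, $F_q=\mathrm{BlockDiag}[F_q(1),\dots,F_q(n_q)]$ (square blocks, one for each relay), the input covariances are $\Sigma=(\Sigma_1,\dots,\Sigma_L)$, $\Sigma_l\succeq 0$. Put $B_{q,q'}=F_{q'}H_{q'-1}F_{q'-1}\cdots H_qF_q$ for $q\le q'$, $$\check H_{l,k}=H_Q^lB_{1,Q}H_0^k,\quad W_l'=W_{Q+1}^l+\sum_{q=1}^QH_Q^lB_{q,Q}W_qB_{q,Q}^\dagger H_Q^{l\dagger},\quad \hat W_l'=\hat W_0^l+\sum_{q=1}^QH_0^{l\dagger}B_{1,q}^\dagger\hat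 W_qB_{1,q}H_0^l ,$$ $$\Omega_l=W_l'+\sum_k\phi_{l,k}\check H_{l,k}\Sigma_k\check H_{l,k}^\dagger,\quad \Sigma_q^R=\sum_lB_{1,q}H_0^l\Sigma_lH_0^{l\dagger}B_{1,q}^\dagger+\sum_{q'\le q}B_{q',q}W_{q'}B_{q',q}^\dagger,$$ and let the Lagrangian of the inner-loop problem be $$L(\Sigma,F)=\sum_lw_l\log\left|I+\check H_{l,l}\Sigma_l\check H_{l,l}^\dagger\Omega_l^{-1}\right|-\sum_l\mathrm{Tr}(\Sigma_l\hat W_0^l)-\sum_q\mathrm{Tr}(\Sigma_q^R\hat W_q).$$ The dual network has input covariances $\hat\Sigma_l\succeq0$ at the destinations and precoders $\hat F_q$ (block diagonal with the same blocks). With $\hat B_{q,q'}=\hat F_{q'}^\dagger H_{q'-1}\hat F_{q'-1}^\dagger\cdots H_q\hat F_q^\dagger$, $\hat H_{l,k}=H_0^{l\dagger}\hat B_{1,Q}^\dagger H_Q^{k\dagger}$ and $$\hat\Omega_l=\hat W_0^l+\sum_qH_0^{l\dagger}\hat B_{1,q}^\dagger\hat W_q\hat B_{1,q}H_0^l+\sum_k\phi_{k,l}\hat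 H_{l,k}\hat\Sigma_k\hat H_{l,k}^\dagger,\quad \hat\Sigma_q^R=\sum_l\hat B_{q,Q}^\dagger H_Q^{l\dagger}\hat\Sigma_lH_Q^l\hat B_{q,Q}+\sum_{q'\ge q}\hat B_{q,q'}^\dagger\hat W_{q'}\hat B_{q,q'},$$ its Lagrangian is $$\hat L(\hat\Sigma,\hat F)=\sum_lw_l\log\left|I+\hat H_{l,l}\hat\Sigma_l\hat H_{l,l}^\dagger\hat\Omega_l^{-1}\right|-\sum_l\mathrm{Tr}(\hat\Sigma_lW_{Q+1}^l)-\sum_q\mathrm{Tr}(\hat\Sigma_q^RW_q).$$ **Stationary points.** $(\Sigma,F)$ is a stationary point of the inner-loop problem $\max L$ s.t. $\Sigma_l\succeq 0$ for all $l$ if it is feasible, all $\Omega_l$ are nonsingular (so that $L$ is defined), and $\nabla_{\Sigma_l}L\preceq0$, $\mathrm{Tr}(\Sigma_l\nabla_{\Sigma_l}L)=0$ for all $l$, $\nabla_{F_q(j)}L=0$ for all $q,j$. Here $G=\nabla_Xf$ means $f(X+D)=f(X)+\mathrm{Re}\,\mathrm{Tr}(G^\dagger D)+o(\|D\|)$,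 with $G$ and $D$ Hermitian for covariances. Stationary points of the dual network problem are defined in the same way from $\hat L$ and $\hat\Omega_l$. **Covariance transformation.** For a one-hop network with channels $H_{l,k}$ (from transmitter $k$ to receiver $l$), noise covariances $W_l$, constraint matrices $\hat W_l$, coupling $\Phi$ and inputs $\Sigma_l$, let $\Omega_l=W_l+\sum_k\phi_{l,k}H_{l,k}\Sigma_kH_{l,k}^\dagger$. Decompose $\Sigma_l=\sum_{m=1}^{M_l}p_{l,m}t_{l,m}t_{l,m}^\dagger$ with $p_{l,m}>0$, $\|t_{l,m}\|=1$. Let $r_{l,m}$ be the unit vector that is a positive multiple of $\big(\sum_{i>m}p_{l,i}H_{l,l}t_{l,i}t_{l,i}^\dagger H_{l,l}^\dagger+\Omega_l\big)^{-1}H_{l,l}t_{l,m}$. Let $\Psi_{(l,m),(k,n)}$ be $0$ if $k=l$, $m\ge n$; $|r_{l,m}^\dagger H_{l,l}t_{l,n}|^2$ if $k=l$, $m<n$; and $\phi_{l,k}|r_{l,m}^\dagger H_{l,k}t_{k,n}|^2$ if $k\ne l$. Let $$\gamma_{l,m}=\frac{p_{l,m}|r_{l,m}^\dagger H_{l,l}t_{l,m}|^2}{r_{l,m}^\dagger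 W_lr_{l,m}+\sum_{k,n}p_{k,n}\Psi_{(l,m),(k,n)}},$$ $D$ the diagonal matrix with entries $\gamma_{l,m}/|r_{l,m}^\dagger H_{l,l}t_{l,m}|^2$, $\hat n_{l,m}=t_{l,m}^\dagger\hat W_lt_{l,m}$, and $\mathbf q=(D^{-1}-\Psi^T)^{-1}\hat n$. The covariance transformation of $\Sigma$ is $\big(\sum_mq_{l,m}r_{l,m}r_{l,m}^\dagger\big)_l$. The Type I dual transformation of a point $(\hat\Sigma,\hat F)$ of the dual network is $(\Sigma,F)$, where $F_q=\hat F_q^\dagger$ and $\Sigma$ is the covariance transformation of $\hat\Sigma$ for the one-hop network with channels $\hat H_{l,k}$ (from destination $k$ to source $l$), noise covariances $\hat W_l'$, constraint matrices $W_l'$ (both evaluated at $F=\hat F^\dagger$) and coupling $\Phi^T$. **Theorem (equivalence of the inner-loop problem and its dual).** Let $(\bar{\hat\Sigma},\bar{\hat F})$ be any stationary point of the dual network problem. Then $\bar{\hat\Sigma}$ has a stream decomposition, and for every such decomposition the Type I dual transformation $(\bar\Sigma,\bar F)$ of $(\bar{\hat\Sigma},\bar{\hat F})$ is well defined (all vectors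 that are normalized are nonzero and all matrices that are inverted are nonsingular) and is a stationary point of the inner-loop problem. Moreover, at these points the gradients with respect to the full (not only block diagonal) matrices $F_q$ and $\hat F_q$ exist and are conjugate transposes of each other: $\nabla_{F_q}L(\bar\Sigma,\bar F)=\big(\nabla_{\hat F_q}\hat L(\bar{\hat\Sigma},\bar{\hat F})\big)^\dagger$ for all $q=1,\dots,Q$. -/

import Mathlib

open Matrix
open scoped ComplexOrder

/-! ## Gradients of real-valued functions of a complex matrix -/

/-- The real-linear functional `D ↦ Re Tr(Gᴴ D)`, i.e. the real inner product with `G`. -/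
noncomputable def matInner {m n : Type*} [Fintype m] [Fintype n] (G : Matrix m n ℂ) :
    Matrix m n ℂ →L[ℝ] ℝ where
  toFun D := (Gᴴ * D).trace.re
  map_add' D E := by simp [Matrix.mul_add]
  map_smul' c D := by simp
  cont := by fun_prop

/-- `G` is the gradient at `X` of `f : ℂ^{m × n} → ℝ`:
`f (X + D) = f X + Re Tr(Gᴴ D) + o(‖D‖)`.  (This is twice the Wirtinger derivative of `f` with
respect to the conjugate of the matrix variable.) -/
def HasMatGrad {m n : Type*} [Fintype m] [Fintype n] (f : Matrix m n ℂ → ℝ)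
    (X G : Matrix m n ℂ) : Prop :=
  HasFDerivAt f (matInner G) X

/-- `G` is the gradient at `X` of `f` as a function on the real vector space of Hermitian
matrices: `G` is Hermitian and `f (X + D) = f X + Re Tr(G D) + o(‖D‖)` for Hermitian `D`. -/
def HasHermGrad {n : Type*} [Fintype n] (f : Matrix n n ℂ → ℝ) (X G : Matrix n n ℂ) : Prop :=
  G.IsHermitian ∧ HasFDerivWithinAt f (matInner G) {Y | Y.IsHermitian} X

/-! ## One-hop interference networks and the covariance transformation -/

/-- Data of a (one-hop) B-MAC interference network with `L` links, where link `l` has `tx l`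
transmit and `rx l` receive antennas. -/
structure IFN (L : ℕ) (tx rx : Fin L → ℕ) where
  /-- coupling matrix -/
  Φ : Matrix (Fin L) (Fin L) ℝ
  /-- `H l k` is the channel from the transmitter of link `k` to the receiver of link `l` -/
  H : ∀ l k, Matrix (Fin (rx l)) (Fin (tx k)) ℂ
  /-- noise covariance matrices at the receivers -/
  W : ∀ l, Matrix (Fin (rx l)) (Fin (rx l)) ℂ
  /-- matrices of the linear constraint on the input covariances -/
  What : ∀ l, Matrix (Fin (tx l)) (Fin (tx l)) ℂ

/-- A decomposition `S l = ∑ m, p l m • t l m (t l m)ᴴ` of the signals into streams, with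
positive transmit powers and unit transmit vectors. -/
structure StreamDecomposition {L : ℕ} {tx : Fin L → ℕ}
    (S : ∀ l, Matrix (Fin (tx l)) (Fin (tx l)) ℂ) where
  M : Fin L → ℕ
  p : ∀ l, Fin (M l) → ℝ
  t : ∀ l, Fin (M l) → Fin (tx l) → ℂ
  p_pos : ∀ l m, 0 < p l m
  t_unit : ∀ l m, ‖WithLp.toLp 2 (t l m)‖ = 1
  sum_eq : ∀ l, S l = ∑ m, (p l m : ℂ) • vecMulVec (t l m) (star (t l m))

namespace IFN

variable {L : ℕ} {tx rx : Fin L → ℕ} (N : IFN L tx rx)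
  (S : ∀ l, Matrix (Fin (tx l)) (Fin (tx l)) ℂ)

/-- Interference-plus-noise covariance `Ω_l = W_l + ∑_k φ_{l,k} H_{l,k} Σ_k H_{l,k}ᴴ`. -/
noncomputable def Omega (l : Fin L) : Matrix (Fin (rx l)) (Fin (rx l)) ℂ :=
  N.W l + ∑ k, (N.Φ l k : ℂ) • (N.H l k * S k * (N.H l k)ᴴ)

/-- Rate `log det (I + H_{l,l} Σ_l H_{l,l}ᴴ Ω_l⁻¹)`. The determinant is real and positive when the
`Σ_k` are positive semidefinite and `Ω_l` is positive definite. -/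
noncomputable def rate (l : Fin L) : ℝ :=
  Real.log (1 + N.H l l * S l * (N.H l l)ᴴ * (N.Omega S l)⁻¹).det.re

variable {S} (d : StreamDecomposition S)

/-- `∑_{i > m} p_{l,i} H_{l,l} t_{l,i} t_{l,i}ᴴ H_{l,l}ᴴ + Ω_l`. -/
noncomputable def sicCov (l : Fin L) (m : Fin (d.M l)) : Matrix (Fin (rx l)) (Fin (rx l)) ℂ :=
  (∑ i ∈ Finset.Ioi m,
    (d.p l i : ℂ) • (N.H l l * vecMulVec (d.t l i) (star (d.t l i)) * (N.H l l)ᴴ)) + N.Omega S l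

/-- The MMSE-SIC receive vector before normalization. -/
noncomputable def mmse (l : Fin L) (m : Fin (d.M l)) : Fin (rx l) → ℂ :=
  (N.sicCov d l m)⁻¹ *ᵥ (N.H l l *ᵥ d.t l m)

/-- The MMSE-SIC receive vector `r_{l,m}`, normalized to have unit Euclidean norm. -/
noncomputable def recv (l : Fin L) (m : Fin (d.M l)) : Fin (rx l) → ℂ :=
  ((‖WithLp.toLp 2 (N.mmse d l m)‖ : ℝ) : ℂ)⁻¹ • N.mmse d l m

/-- `|r_{l,m}ᴴ H_{l,k} t_{k,n}|²`. -/
noncomputable def gain (l : Fin L) (m : Fin (d.M l)) (k : Fin L) (n : Fin (d.M k)) : ℝ :=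
  ‖star (N.recv d l m) ⬝ᵥ (N.H l k *ᵥ d.t k n)‖ ^ 2

/-- The cross-talk matrix `Ψ`, with rows `(l,m)` and columns `(k,n)`. -/
noncomputable def Psi :
    Matrix (Σ l : Fin L, Fin (d.M l)) (Σ l : Fin L, Fin (d.M l)) ℝ :=
  Matrix.of fun a b =>
    if a.1 = b.1 then
      if (b.2 : ℕ) ≤ (a.2 : ℕ) then 0 else N.gain d a.1 a.2 b.1 b.2
    else N.Φ a.1 b.1 * N.gain d a.1 a.2 b.1 b.2

/-- The SINR `γ_{l,m}` of a stream: received signal power over the power of noise and cross-talk. -/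
noncomputable def sinr (a : Σ l : Fin L, Fin (d.M l)) : ℝ :=
  d.p a.1 a.2 * N.gain d a.1 a.2 a.1 a.2 /
    ((star (N.recv d a.1 a.2) ⬝ᵥ (N.W a.1 *ᵥ N.recv d a.1 a.2)).re +
      ∑ b : Σ l : Fin L, Fin (d.M l), d.p b.1 b.2 * N.Psi d a b)

/-- The diagonal matrix `D` with entries `γ_{l,m} / |r_{l,m}ᴴ H_{l,l} t_{l,m}|²`. -/
noncomputable def Dmat :
    Matrix (Σ l : Fin L, Fin (d.M l)) (Σ l : Fin L, Fin (d.M l)) ℝ :=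
  Matrix.diagonal fun a => N.sinr d a / N.gain d a.1 a.2 a.1 a.2

/-- `n̂_{l,m} = t_{l,m}ᴴ Ŵ_l t_{l,m}`. -/
noncomputable def nhat (a : Σ l : Fin L, Fin (d.M l)) : ℝ :=
  (star (d.t a.1 a.2) ⬝ᵥ (N.What a.1 *ᵥ d.t a.1 a.2)).re

/-- Reverse transmit powers `q = (D⁻¹ - Ψᵀ)⁻¹ n̂`. -/
noncomputable def revPower : (Σ l : Fin L, Fin (d.M l)) → ℝ :=
  ((N.Dmat d)⁻¹ - (N.Psi d)ᵀ)⁻¹ *ᵥ N.nhat d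

/-- The covariance transformation `Σ̂_l = ∑ m, q_{l,m} r_{l,m} r_{l,m}ᴴ` of `S`, computed from the
stream decomposition `d` of `S`. -/
noncomputable def covTransform (l : Fin L) : Matrix (Fin (rx l)) (Fin (rx l)) ℂ :=
  ∑ m : Fin (d.M l),
    (N.revPower d ⟨l, m⟩ : ℂ) • vecMulVec (N.recv d l m) (star (N.recv d l m))

/-- All inverses and normalizations in the covariance transformation make sense. -/
def TransformDefined : Prop :=
  (∀ l m, IsUnit (N.sicCov d l m).det) ∧ (∀ l m, N.mmse d l m ≠ 0) ∧
    IsUnit (N.Dmat d).det ∧ IsUnit ((N.Dmat d)⁻¹ - (N.Psi d)ᵀ).det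

end IFN

/-! ## Multi-hop amplify-and-forward relay networks -/

/-- A B-MAC AF relay network with `L` links and `Q = n + 1 ≥ 1` relay clusters (cluster `q + 1` of
the usual numbering is `q : Fin (n + 1)` here), together with the constraint matrices. -/
structure RelayNetwork where
  /-- number of data links -/
  L : ℕ
  /-- number of relay clusters minus one -/
  n : ℕ
  /-- number of antennas at the source of each link -/
  src : Fin L → ℕ
  /-- number of antennas at the destination of each link -/
  dst : Fin L → ℕ
  /-- number of relays in each cluster -/
  relays : Fin (n + 1) → ℕ
  /-- number of antennas at each relay -/
  ant : ∀ q, Fin (relays q) → ℕ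
  /-- channel from the source of link `l` to the first cluster -/
  H0 : ∀ l, Matrix (Σ j : Fin (relays 0), Fin (ant 0 j)) (Fin (src l)) ℂ
  /-- channel between consecutive clusters -/
  H : ∀ q : Fin n, Matrix (Σ j : Fin (relays q.succ), Fin (ant q.succ j))
    (Σ j : Fin (relays q.castSucc), Fin (ant q.castSucc j)) ℂ
  /-- channel from the last cluster to the destination of link `l` -/
  HQ : ∀ l, Matrix (Fin (dst l)) (Σ j : Fin (relays (Fin.last n)), Fin (ant (Fin.last n) j)) ℂ
  /-- noise covariances at the relay clusters -/
  W : ∀ q, Matrix (Σ j : Fin (relays q), Fin (ant q j)) (Σ j : Fin (relays q), Fin (ant q j)) ℂ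
  /-- noise covariances at the destinations -/
  Wdst : ∀ l, Matrix (Fin (dst l)) (Fin (dst l)) ℂ
  /-- constraint matrices at the relay clusters -/
  What : ∀ q, Matrix (Σ j : Fin (relays q), Fin (ant q j)) (Σ j : Fin (relays q), Fin (ant q j)) ℂ
  /-- constraint matrices at the sources -/
  Wsrc : ∀ l, Matrix (Fin (src l)) (Fin (src l)) ℂ
  /-- coupling matrix -/
  Φ : Matrix (Fin L) (Fin L) ℝ
  W_psd : ∀ q, (W q).PosSemidef
  Wdst_pd : ∀ l, (Wdst l).PosDef
  What_psd : ∀ q, (What q).PosSemidef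
  Wsrc_psd : ∀ l, (Wsrc l).PosSemidef
  Φ_binary : ∀ l k, Φ l k = 0 ∨ Φ l k = 1
  Φ_diag : ∀ l, Φ l l = 0

namespace RelayNetwork

variable (N : RelayNetwork)

/-- The antennas of the `q`-th relay cluster. -/
abbrev Cl (q : Fin (N.n + 1)) : Type := Σ j : Fin (N.relays q), Fin (N.ant q j)

/-- Composite relay precoding matrices, one for each cluster. -/
abbrev Precoder : Type := ∀ q, Matrix (N.Cl q) (N.Cl q) ℂ

/-- Relay precoding matrices of the individual relays. -/
abbrev RelayPrecoder : Type := ∀ q (j : Fin (N.relays q)), Matrix (Fin (N.ant q j)) (Fin (N.ant q j)) ℂ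

/-- Input covariances at the sources. -/
abbrev SrcCov : Type := ∀ l, Matrix (Fin (N.src l)) (Fin (N.src l)) ℂ

/-- Input covariances at the destinations (the sources of the dual network). -/
abbrev DstCov : Type := ∀ l, Matrix (Fin (N.dst l)) (Fin (N.dst l)) ℂ

/-- `F_q = BlockDiag[F_q(1), …, F_q(n_q)]`. -/
def composite (F : N.RelayPrecoder) : N.Precoder := fun q => blockDiagonal' (F q)

/-- The identity matrix if `q = q'`, and zero otherwise. -/
def idAt (q q' : Fin (N.n + 1)) : Matrix (N.Cl q') (N.Cl q) ℂ :=
  Matrix.of fun a b => if (⟨q', a⟩ : Σ i, N.Cl i) = ⟨q, b⟩ then 1 else 0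

/-- `B_{q,q'} = F_{q'} H_{q'-1} F_{q'-1} ⋯ H_q F_q` for `q ≤ q'`, and `0` for `q > q'`
(see `B_self`, `B_succ`, `B_of_lt`). -/
noncomputable def B (F : N.Precoder) (q q' : Fin (N.n + 1)) : Matrix (N.Cl q') (N.Cl q) ℂ :=
  Fin.induction (motive := fun i => Matrix (N.Cl i) (N.Cl q) ℂ)
    (F 0 * N.idAt q 0) (fun i b => F i.succ * (N.idAt q i.succ + N.H i * b)) q'

theorem idAt_self (q : Fin (N.n + 1)) : N.idAt q q = 1 := by
  ext a b
  simp [idAt, Matrix.one_apply]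

theorem idAt_ne {q q' : Fin (N.n + 1)} (h : q ≠ q') : N.idAt q q' = 0 := by
  ext a b
  simp only [idAt, Matrix.of_apply, Matrix.zero_apply, ite_eq_right_iff]
  intro e
  exact absurd (congrArg Sigma.fst e).symm h

theorem B_zero (F : N.Precoder) (q : Fin (N.n + 1)) : N.B F q 0 = F 0 * N.idAt q 0 := rfl

theorem B_step (F : N.Precoder) (q : Fin (N.n + 1)) (i : Fin N.n) :
    N.B F q i.succ = F i.succ * (N.idAt q i.succ + N.H i * N.B F q i.castSucc) := rfl

theorem B_of_lt (F : N.Precoder) (q q' : Fin (N.n + 1)) (h : q' < q) : N.B F q q' = 0 := by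
  induction q' using Fin.induction with
  | zero => rw [B_zero, idAt_ne _ h.ne', Matrix.mul_zero]
  | succ i ih =>
    rw [B_step, idAt_ne _ h.ne', ih (lt_trans i.castSucc_lt_succ h)]
    simp

theorem B_self (F : N.Precoder) (q : Fin (N.n + 1)) : N.B F q q = F q := by
  induction q using Fin.cases with
  | zero => rw [B_zero, idAt_self, Matrix.mul_one]
  | succ i => rw [B_step, idAt_self, B_of_lt _ _ _ _ i.castSucc_lt_succ]; simp

theorem B_succ (F : N.Precoder) (q : Fin (N.n + 1)) (i : Fin N.n) (h : q ≤ i.castSucc) :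
    N.B F q i.succ = F i.succ * N.H i * N.B F q i.castSucc := by
  rw [B_step, idAt_ne _ (lt_of_le_of_lt h i.castSucc_lt_succ).ne, zero_add, Matrix.mul_assoc]

/-- End-to-end channel `Ȟ_{l,k} = H_Q^l B_{1,Q} H_0^k`. -/
noncomputable def chan (F : N.Precoder) (l k : Fin N.L) :
    Matrix (Fin (N.dst l)) (Fin (N.src k)) ℂ :=
  N.HQ l * N.B F 0 (Fin.last N.n) * N.H0 k

/-- `W'_l = ∑_q H_Q^l B_{q,Q} W_q B_{q,Q}ᴴ H_Q^{l}ᴴ + W_{Q+1}^l`. -/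
noncomputable def noise (F : N.Precoder) (l : Fin N.L) :
    Matrix (Fin (N.dst l)) (Fin (N.dst l)) ℂ :=
  (∑ q, N.HQ l * N.B F q (Fin.last N.n) * N.W q * (N.B F q (Fin.last N.n))ᴴ * (N.HQ l)ᴴ) + N.Wdst l

/-- `Ŵ'_l = ∑_q H_0^{l}ᴴ B_{1,q}ᴴ Ŵ_q B_{1,q} H_0^l + Ŵ_0^l`. -/
noncomputable def cost (F : N.Precoder) (l : Fin N.L) :
    Matrix (Fin (N.src l)) (Fin (N.src l)) ℂ :=
  (∑ q, (N.H0 l)ᴴ * (N.B F 0 q)ᴴ * N.What q * N.B F 0 q * N.H0 l) + N.Wsrc l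

/-- The one-hop network seen by sources and destinations when the precoders are fixed to `F`. -/
noncomputable def ifn (F : N.Precoder) : IFN N.L N.src N.dst where
  Φ := N.Φ
  H := N.chan F
  W := N.noise F
  What := N.cost F

/-- Covariance of the transmit signal at the `q`-th relay cluster. -/
noncomputable def relayCov (S : N.SrcCov) (F : N.Precoder) (q : Fin (N.n + 1)) :
    Matrix (N.Cl q) (N.Cl q) ℂ :=
  (∑ l, N.B F 0 q * N.H0 l * S l * (N.H0 l)ᴴ * (N.B F 0 q)ᴴ) +
    ∑ q' ∈ Finset.Iic q, N.B F q' q * N.W q' * (N.B F q' q)ᴴ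

/-- The Lagrangian
`∑_l w_l I_l(Σ,F) - ∑_l Tr(Σ_l Ŵ_0^l) - ∑_q Tr(Σ_q^R Ŵ_q)`. -/
noncomputable def lagrangian (w : Fin N.L → ℝ) (S : N.SrcCov) (F : N.Precoder) : ℝ :=
  (∑ l, w l * (N.ifn F).rate S l) - (∑ l, (S l * N.Wsrc l).trace.re) -
    ∑ q, (N.relayCov S F q * N.What q).trace.re

/-! ### The dual network -/

/-- The precoders `(F_1ᴴ, …, F_Qᴴ)`. -/
def adj (F : N.Precoder) : N.Precoder := fun q => (F q)ᴴ

/-- `B̂_{q,q'} = F̂_{q'}ᴴ H_{q'-1} F̂_{q'-1}ᴴ ⋯ H_q F̂_qᴴ`. -/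
noncomputable def Bhat (Fh : N.Precoder) (q q' : Fin (N.n + 1)) : Matrix (N.Cl q') (N.Cl q) ℂ :=
  N.B (N.adj Fh) q q'

/-- The one-hop network seen in the dual network for fixed dual precoders `Fh`: the channel from
the dual source `R_k` to the dual destination `T_l` is `H_0^{l}ᴴ B̂_{1,Q}ᴴ H_Q^{k}ᴴ`; the noise
covariance at `T_l` is `Ŵ_0^l + ∑_q H_0^{l}ᴴ B̂_{1,q}ᴴ Ŵ_q B̂_{1,q} H_0^l`; the constraint matrix at
`R_l` is `W_{Q+1}^l + ∑_q H_Q^l B̂_{q,Q} W_q B̂_{q,Q}ᴴ H_Q^{l}ᴴ`. -/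
noncomputable def dualIfn (Fh : N.Precoder) : IFN N.L N.dst N.src where
  Φ := N.Φᵀ
  H := fun l k => (N.H0 l)ᴴ * (N.Bhat Fh 0 (Fin.last N.n))ᴴ * (N.HQ k)ᴴ
  W := fun l =>
    N.Wsrc l + ∑ q, (N.H0 l)ᴴ * (N.Bhat Fh 0 q)ᴴ * N.What q * N.Bhat Fh 0 q * N.H0 l
  What := fun l =>
    (∑ q, N.HQ l * N.Bhat Fh q (Fin.last N.n) * N.W q * (N.Bhat Fh q (Fin.last N.n))ᴴ * (N.HQ l)ᴴ)
      + N.Wdst l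

/-- Covariance of the transmit signal at the `q`-th relay cluster of the dual network. -/
noncomputable def dualRelayCov (Sh : N.DstCov) (Fh : N.Precoder) (q : Fin (N.n + 1)) :
    Matrix (N.Cl q) (N.Cl q) ℂ :=
  (∑ l, (N.Bhat Fh q (Fin.last N.n))ᴴ * (N.HQ l)ᴴ * Sh l * N.HQ l * N.Bhat Fh q (Fin.last N.n)) +
    ∑ q' ∈ Finset.Ici q, (N.Bhat Fh q q')ᴴ * N.What q' * N.Bhat Fh q q'

/-- The Lagrangian of the dual network,
`∑_l w_l Î_l(Σ̂,F̂) - ∑_l Tr(Σ̂_l W_{Q+1}^l) - ∑_q Tr(Σ̂_q^R W_q)`. -/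
noncomputable def dualLagrangian (w : Fin N.L → ℝ) (Sh : N.DstCov) (Fh : N.Precoder) : ℝ :=
  (∑ l, w l * (N.dualIfn Fh).rate Sh l) - (∑ l, (Sh l * N.Wdst l).trace.re) -
    ∑ q, (N.dualRelayCov Sh Fh q * N.W q).trace.re

/-! ### Stationary points -/

/-- First-order (KKT) conditions for maximizing `Lag` over covariances `S l ⪰ 0` and the relay
precoding matrices `F q j`:
`∇_{S_l} Lag ⪯ 0`, `Tr(S_l ∇_{S_l} Lag) = 0` and `∇_{F_q(j)} Lag = 0`. -/
def KKT {a : Fin N.L → ℕ}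
    (Lag : (∀ l, Matrix (Fin (a l)) (Fin (a l)) ℂ) → N.Precoder → ℝ)
    (S : ∀ l, Matrix (Fin (a l)) (Fin (a l)) ℂ) (F : N.RelayPrecoder) : Prop :=
  (∀ l, (S l).PosSemidef) ∧
  (∀ l, ∃ G, HasHermGrad (fun X => Lag (Function.update S l X) (N.composite F)) (S l) G ∧
    (-G).PosSemidef ∧ (S l * G).trace = 0) ∧
  ∀ q j, HasMatGrad
    (fun X => Lag S (N.composite (Function.update F q (Function.update (F q) j X)))) (F q j) 0

/-- Stationary point of the inner-loop problem: the interference-plus-noise covariances are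
nonsingular (so that the point lies in the domain of the Lagrangian) and the KKT conditions hold. -/
def IsStationary (w : Fin N.L → ℝ) (S : N.SrcCov) (F : N.RelayPrecoder) : Prop :=
  (∀ l, IsUnit ((N.ifn (N.composite F)).Omega S l).det) ∧ N.KKT (N.lagrangian w) S F

/-- Stationary point of the dual network problem. -/
def IsDualStationary (w : Fin N.L → ℝ) (Sh : N.DstCov) (Fh : N.RelayPrecoder) : Prop :=
  (∀ l, IsUnit ((N.dualIfn (N.composite Fh)).Omega Sh l).det) ∧ N.KKT (N.dualLagrangian w) Sh Fh

/-- Type I dual transformation applied to the dual network (whose dual is the original network),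
covariance part, for a chosen stream decomposition of the dual covariances. -/
noncomputable def typeICov {Sh : N.DstCov} (Fh : N.RelayPrecoder) (d : StreamDecomposition Sh) :
    N.SrcCov :=
  (N.dualIfn (N.composite Fh)).covTransform d

/-- Type I dual transformation, precoder part: `F_q(j) = F̂_q(j)ᴴ`, i.e. `F_q = F̂_qᴴ`. -/
def typeIPrec (Fh : N.RelayPrecoder) : N.RelayPrecoder := fun q j => (Fh q j)ᴴ

end RelayNetwork

/-! For fixed precoders the relay network is a one-hop interference network whose channels, noise
and cost matrices depend on `F`. With `F̂ = Fᴴ`, the dual relay network is exactly the one-hop dual: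
channels reversed, noise and constraint matrices exchanged (`dualIfn_adj`). Each Lagrangian is the
corresponding one-hop Lagrangian minus the same function of `F` (`lagrangian_eq`,
`dualLagrangian_adj_eq`), so the theorem becomes one about a one-hop network depending on a
parameter.

Covariances. Write `Z_l = Ω_l + H Σ_l Hᴴ` and `T_l = w_l (Ω_l⁻¹ - Z_l⁻¹)` with `H = H_{l,l}`. The
gradient in `Σ_l` is `w_l Hᴴ Z_l⁻¹ H - Ω̂_l`, where `Ω̂_l` is the reverse interference-plus-noise
covariance produced by `T`. The KKT conditions thus couple `Ω_l`, `Ω̂_l`, `Σ_l`, `T_l` link by link,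
and matrix algebra shows that the relation is symmetric: `Σ_l` arises from `T_l` by the same formula
(`polite_involutive`), `T` satisfies the reverse KKT conditions (`dual_lagGrad`), and `T_l H Ẑ_l⁻¹ =
Z_l⁻¹ H Σ_l` (`politeDual_mul_mul_inv`), with `Ẑ_l = Ω̂_l + Hᴴ T_l H`.

The covariance transformation produces this `T` for every stream decomposition: successive
cancellation telescopes `Ω_l⁻¹ - Z_l⁻¹` into rank-one terms along the receive vectors, and by the
KKT conditions their coefficients solve the linear system defining the reverse powers
(`transformDefined_and_covTransform_eq`).

Precoders. Replace each rate by its linearization. The interference and noise terms of the two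
Lagrangians agree for every `F`, since weighted interference can be counted at receivers or at
transmitters (`sum_matInner_Omega`); the signal terms agree to first order by the identity for `T_l
H Ẑ_l⁻¹`. Hence `L(Σ, F) - L̂(Σ̂, Fᴴ)` has zero derivative in `F` (`hasFDerivAt_lag_sub_dual`). This
gives the statement on full gradients, and its restriction to diagonal blocks gives stationarity in
the precoders. -/

/-! ## Differential calculus of matrix-valued maps -/

section MatrixCalculus

/-- The elementwise supremum norm on complex matrices, inducing the standard topology and additive
structure up to reducible unfolding. -/
@[reducible]
noncomputable def Matrix.supNormedAddCommGroup {m n : Type*} [Fintype m] [Fintype n] :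
    NormedAddCommGroup (Matrix m n ℂ) :=
  { toAddCommGroup := (Matrix.addCommGroup : AddCommGroup (Matrix m n ℂ))
    norm := fun A => ‖(show m → n → ℂ from A)‖
    toMetricSpace := (show MetricSpace (Matrix m n ℂ) from
      (inferInstance : MetricSpace (m → n → ℂ))).replaceTopology
        (U := instTopologicalSpaceMatrix) rfl
    dist_eq := fun A B => dist_eq_norm_neg_add (show m → n → ℂ from A) B }

attribute [local instance] Matrix.supNormedAddCommGroup

/-- The real normed space structure belonging to `Matrix.supNormedAddCommGroup`. -/
@[reducible]
noncomputable def Matrix.supNormedSpace {m n : Type*} [Fintype m] [Fintype n] :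
    NormedSpace ℝ (Matrix m n ℂ) :=
  { toModule := (Matrix.module : Module ℝ (Matrix m n ℂ))
    norm_smul_le := fun c A => norm_smul_le c (show m → n → ℂ from A) }

attribute [local instance] Matrix.supNormedSpace

variable {E : Type*} [NormedAddCommGroup E] [NormedSpace ℝ E]
variable {l m n : Type*} [Fintype l] [Fintype m] [Fintype n]

theorem matInner_apply (G D : Matrix m n ℂ) : matInner G D = (Gᴴ * D).trace.re := rfl

/-- Matrix multiplication as a continuous real-bilinear map. -/
noncomputable def Matrix.mulCLM :
    Matrix l m ℂ →L[ℝ] Matrix m n ℂ →L[ℝ] Matrix l n ℂ :=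
  LinearMap.toContinuousLinearMap
    ((LinearMap.toContinuousLinearMap
      (E := Matrix m n ℂ) (F' := Matrix l n ℂ) (𝕜 := ℝ)).toLinearMap ∘ₗ
      LinearMap.mk₂ ℝ (fun (A : Matrix l m ℂ) (B : Matrix m n ℂ) => A * B)
        Matrix.add_mul (fun c A B => Matrix.smul_mul c A B) Matrix.mul_add
        (fun c A B => Matrix.mul_smul A c B))

@[simp] theorem Matrix.mulCLM_apply (A : Matrix l m ℂ) (B : Matrix m n ℂ) :
    Matrix.mulCLM A B = A * B := rfl

/-- The conjugate transpose as a continuous real-linear map. -/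
noncomputable def Matrix.conjTransposeCLM : Matrix m n ℂ →L[ℝ] Matrix n m ℂ :=
  LinearMap.toContinuousLinearMap
    { toFun := fun A => Aᴴ
      map_add' := Matrix.conjTranspose_add
      map_smul' := fun c A => by ext; simp }

@[simp] theorem Matrix.conjTransposeCLM_apply (A : Matrix m n ℂ) :
    Matrix.conjTransposeCLM A = Aᴴ := rfl

/-- `D ↦ Tr(M D)` as a continuous real-linear map. -/
noncomputable def Matrix.traceMulCLM (M : Matrix n m ℂ) : Matrix m n ℂ →L[ℝ] ℂ :=
  LinearMap.toContinuousLinearMap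
    { toFun := fun D => (M * D).trace
      map_add' := fun A B => by simp [Matrix.mul_add]
      map_smul' := fun c A => by simp }

@[simp] theorem Matrix.traceMulCLM_apply (M : Matrix n m ℂ) (D : Matrix m n ℂ) :
    Matrix.traceMulCLM M D = (M * D).trace := rfl

theorem HasFDerivAt.matrix_mul {A : E → Matrix l m ℂ} {B : E → Matrix m n ℂ}
    {A' : E →L[ℝ] Matrix l m ℂ} {B' : E →L[ℝ] Matrix m n ℂ} {x : E}
    (hA : HasFDerivAt A A' x) (hB : HasFDerivAt B B' x) :
    HasFDerivAt (fun y => A y * B y)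
      ((Matrix.mulCLM (A x)).comp B' + (Matrix.mulCLM.flip (B x)).comp A') x :=
  Matrix.mulCLM.hasFDerivAt_of_bilinear hA hB

theorem DifferentiableAt.matrix_mul {A : E → Matrix l m ℂ} {B : E → Matrix m n ℂ} {x : E}
    (hA : DifferentiableAt ℝ A x) (hB : DifferentiableAt ℝ B x) :
    DifferentiableAt ℝ (fun y => A y * B y) x :=
  (hA.hasFDerivAt.matrix_mul hB.hasFDerivAt).differentiableAt

theorem DifferentiableAt.matrix_conjTranspose {A : E → Matrix m n ℂ} {x : E}
    (hA : DifferentiableAt ℝ A x) : DifferentiableAt ℝ (fun y => (A y)ᴴ) x :=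
  (Matrix.conjTransposeCLM.differentiableAt (x := A x)).comp x hA

theorem DifferentiableAt.matInner_comp (G : Matrix m n ℂ) {A : E → Matrix m n ℂ} {x : E}
    (hA : DifferentiableAt ℝ A x) : DifferentiableAt ℝ (fun y => matInner G (A y)) x :=
  ((matInner G).differentiableAt (x := A x)).comp x hA

section Det

variable [DecidableEq n]

/-- Jacobi's formula. The determinant is multilinear in the rows, so its derivative is a sum of
determinants with one row replaced; Cramer's rule expands each of them through the adjugate. -/
theorem Matrix.hasFDerivAt_det_of_isUnit (A : Matrix n n ℂ) (hA : IsUnit A.det) :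
    HasFDerivAt (fun X : Matrix n n ℂ => X.det)
      (A.det • Matrix.traceMulCLM A⁻¹ : Matrix n n ℂ →L[ℝ] ℂ) A := by
  let f : ContinuousMultilinearMap ℂ (fun _ : n => n → ℂ) ℂ :=
    { toMultilinearMap := (Matrix.detRowAlternating (R := ℂ) (n := n)).toMultilinearMap
      cont := by
        change Continuous (fun X : Matrix n n ℂ => X.det)
        fun_prop }
  have h := (f.hasFDerivAt (fun i j => A i j)).restrictScalars ℝ
  refine HasFDerivAt.congr_fderiv (f' := (show Matrix n n ℂ →L[ℝ] ℂ from
    (f.linearDeriv (fun i j => A i j)).restrictScalars ℝ)) h ?_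
  refine ContinuousLinearMap.ext fun D : Matrix n n ℂ => ?_
  have h1 : f.linearDeriv (fun i j => A i j) (fun i j => D i j) =
      ∑ i, (A.updateRow i (D.row i)).det := by
    rw [ContinuousMultilinearMap.linearDeriv_apply]
    rfl
  have h2 : ∀ i, (A.updateRow i (D.row i)).det = ∑ j, A.adjugate j i * D i j := by
    intro i
    rw [← Matrix.cramer_transpose_apply, Matrix.cramer_eq_adjugate_mulVec,
      ← Matrix.adjugate_transpose]
    rfl
  change f.linearDeriv (fun i j => A i j) (fun i j => D i j) = A.det • (A⁻¹ * D).trace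
  rw [h1, Finset.sum_congr rfl fun i _ => h2 i, ← Matrix.trace_smul, ← Matrix.smul_mul,
    Matrix.inv_def, smul_smul, Ring.mul_inverse_cancel _ hA, one_smul, Matrix.trace_mul_comm]
  simp only [Matrix.trace, Matrix.diag, Matrix.mul_apply]
  exact Finset.sum_congr rfl fun i _ => Finset.sum_congr rfl fun j _ => mul_comm _ _

theorem Matrix.PosDef.det_re_pos {A : Matrix n n ℂ} (hA : A.PosDef) :
    0 < A.det.re ∧ A.det.im = 0 := by
  have := hA.det_pos
  rw [Complex.lt_def] at this
  exact ⟨by simpa using this.1, by simpa using this.2.symm⟩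

/-- Away from `x` the matrices need not be Hermitian, so the quotient of determinants may be
complex; at `x` both determinants are positive reals, which makes the logarithm differentiable and
lets the determinants cancel from the derivative. -/
theorem HasFDerivAt.log_det_div {A B : E → Matrix n n ℂ} {A' B' : E →L[ℝ] Matrix n n ℂ} {x : E}
    (hA : HasFDerivAt A A' x) (hB : HasFDerivAt B B' x) (pA : (A x).PosDef) (pB : (B x).PosDef) :
    HasFDerivAt (fun y => Real.log ((A y).det / (B y).det).re)
      ((matInner (A x)⁻¹).comp A' - (matInner (B x)⁻¹).comp B') x := by
  have uA : IsUnit (A x).det := (Matrix.isUnit_iff_isUnit_det _).1 pA.isUnit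
  have uB : IsUnit (B x).det := (Matrix.isUnit_iff_isUnit_det _).1 pB.isUnit
  have dA : HasFDerivAt (𝕜 := ℝ) (fun y => (A y).det) _ x :=
    (Matrix.hasFDerivAt_det_of_isUnit _ uA).comp x hA
  have dB : HasFDerivAt (𝕜 := ℝ) (fun y => (B y).det) _ x :=
    (Matrix.hasFDerivAt_det_of_isUnit _ uB).comp x hB
  have hdiv := dA.mul ((hasFDerivAt_inv (𝕜 := ℂ) uB.ne_zero).restrictScalars ℝ |>.comp x dB)
  have hre := (Complex.reCLM.hasFDerivAt).comp x hdiv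
  obtain ⟨a0, a1⟩ := pA.det_re_pos
  obtain ⟨b0, b1⟩ := pB.det_re_pos
  obtain ⟨a, ha⟩ : ∃ a : ℝ, (A x).det = a := ⟨_, Complex.ext rfl (by simpa using a1)⟩
  obtain ⟨b, hb⟩ : ∃ b : ℝ, (B x).det = b := ⟨_, Complex.ext rfl (by simpa using b1)⟩
  rw [ha, Complex.ofReal_re] at a0
  rw [hb, Complex.ofReal_re] at b0
  have hval : ((A x).det / (B x).det).re = a / b := by
    rw [ha, hb, ← Complex.ofReal_div, Complex.ofReal_re]
  have hlog := hre.log (by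
    change ((A x).det * ((B x).det)⁻¹).re ≠ 0
    rw [← div_eq_mul_inv, hval]
    positivity)
  refine hlog.congr_fderiv ?_
  ext v
  have iA : ((A x)⁻¹)ᴴ = (A x)⁻¹ := pA.inv.isHermitian
  have iB : ((B x)⁻¹)ᴴ = (B x)⁻¹ := pB.inv.isHermitian
  have hr : ((b : ℂ) ^ 2).re = b ^ 2 := by rw [← Complex.ofReal_pow, Complex.ofReal_re]
  have hi : ((b : ℂ) ^ 2).im = 0 := by rw [← Complex.ofReal_pow, Complex.ofReal_im]
  simp [matInner_apply, iA, iB, ha, hb, hr, hi]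
  field_simp
  ring

/-- To first order, `log det (1 + K Ω⁻¹)` agrees with
`Re Tr((Ω₀ + K₀)⁻¹ (Ω + K)) - Re Tr(Ω₀⁻¹ Ω)` up to a constant. -/
theorem hasFDerivAt_log_det_sub {K Om : E → Matrix n n ℂ} {x : E}
    (hK : DifferentiableAt ℝ K x) (hO : DifferentiableAt ℝ Om x)
    (pK : (K x).PosSemidef) (pO : (Om x).PosDef) :
    HasFDerivAt (fun y => Real.log (1 + K y * (Om y)⁻¹).det.re -
      (matInner (Om x + K x)⁻¹ (Om y + K y) - matInner (Om x)⁻¹ (Om y))) (0 : E →L[ℝ] ℝ) x := by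
  have hA := hO.hasFDerivAt.add hK.hasFDerivAt
  have h1 := hA.log_det_div hO.hasFDerivAt (pO.add_posSemidef pK) pO
  -- `Om y` stays nonsingular near `x`, where `1 + K Ω⁻¹ = (Ω + K) Ω⁻¹`.
  have hev : (fun y => Real.log (1 + K y * (Om y)⁻¹).det.re) =ᶠ[nhds x]
      fun y => Real.log ((Om y + K y).det / (Om y).det).re := by
    have hdet : ContinuousAt (fun y => (Om y).det) x :=
      (Continuous.matrix_det continuous_id).continuousAt.comp hO.continuousAt
    have hne : (Om x).det ≠ 0 := ((Matrix.isUnit_iff_isUnit_det _).1 pO.isUnit).ne_zero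
    filter_upwards [hdet.eventually_ne hne] with y hy
    have e : 1 + K y * (Om y)⁻¹ = (Om y + K y) * (Om y)⁻¹ := by
      rw [Matrix.add_mul, Matrix.mul_nonsing_inv _ (isUnit_iff_ne_zero.2 hy)]
    rw [e, Matrix.det_mul, Matrix.det_nonsing_inv, Ring.inverse_eq_inv', div_eq_mul_inv]
  have h2 := h1.congr_of_eventuallyEq hev
  have h3 : HasFDerivAt (𝕜 := ℝ) (fun y => matInner (Om x + K x)⁻¹ (Om y + K y)) _ x :=
    (matInner (Om x + K x)⁻¹).hasFDerivAt.comp x hA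
  have h4 : HasFDerivAt (𝕜 := ℝ) (fun y => matInner (Om x)⁻¹ (Om y)) _ x :=
    (matInner (Om x)⁻¹).hasFDerivAt.comp x hO.hasFDerivAt
  refine (h2.sub (h3.sub h4)).congr_fderiv ?_
  exact sub_self _

end Det

theorem matInner_eq_of_isHermitian {G : Matrix n n ℂ} (hG : G.IsHermitian) (D : Matrix n n ℂ) :
    matInner G D = (G * D).trace.re := by
  rw [matInner_apply, hG.eq]

/-- In the product rule, `h` matches the two terms linear in the increment `D`, and the conjugate
transpose of `h` matches the two terms linear in `Dᴴ`. This is how the desired-signal terms of a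
link and its reverse cancel. -/
theorem hasFDerivAt_quadratic_sub {A : E → Matrix m n ℂ} {x : E} (hA : DifferentiableAt ℝ A x)
    {C S' : Matrix m m ℂ} {C' S : Matrix n n ℂ} (hC : C.IsHermitian) (hC' : C'.IsHermitian)
    (hS : S.IsHermitian) (hS' : S'.IsHermitian) (h : S * (A x)ᴴ * C = C' * (A x)ᴴ * S') :
    HasFDerivAt (fun y => matInner C (A y * S * (A y)ᴴ) - matInner C' ((A y)ᴴ * S' * A y))
      (0 : E →L[ℝ] ℝ) x := by
  have dA := hA.hasFDerivAt
  have dAh : HasFDerivAt (𝕜 := ℝ) (fun y => (A y)ᴴ) _ x := 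
    (Matrix.conjTransposeCLM.hasFDerivAt (x := A x)).comp x dA
  have d1 := (dA.matrix_mul (hasFDerivAt_const S x)).matrix_mul dAh
  have d2 := (dAh.matrix_mul (hasFDerivAt_const S' x)).matrix_mul dA
  have e1 : HasFDerivAt (𝕜 := ℝ) (fun y => matInner C (A y * S * (A y)ᴴ)) _ x :=
    (matInner C).hasFDerivAt.comp x d1
  have e2 : HasFDerivAt (𝕜 := ℝ) (fun y => matInner C' ((A y)ᴴ * S' * A y)) _ x :=
    (matInner C').hasFDerivAt.comp x d2
  refine (e1.sub e2).congr_fderiv ?_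
  ext v
  have h' : C * A x * S = S' * A x * C' := by
    have := congrArg Matrix.conjTranspose h
    simpa [Matrix.conjTranspose_mul, hC.eq, hC'.eq, hS.eq, hS'.eq, Matrix.mul_assoc] using this
  set D : Matrix m n ℂ := fderiv ℝ A x v with hD
  have t1 : (C * (A x * S * Dᴴ)).trace = (C' * (Dᴴ * S' * A x)).trace := by
    rw [← Matrix.mul_assoc, ← Matrix.mul_assoc, h', ← Matrix.mul_assoc, Matrix.trace_mul_comm,
      ← Matrix.mul_assoc, Matrix.trace_mul_comm]
    simp only [Matrix.mul_assoc]
  have t2 : (C * (D * S * (A x)ᴴ)).trace = (C' * ((A x)ᴴ * S' * D)).trace := by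
    rw [← Matrix.mul_assoc C', ← Matrix.mul_assoc C', ← h, Matrix.trace_mul_comm C,
      Matrix.mul_assoc D, Matrix.mul_assoc D, Matrix.trace_mul_comm D]
  have t1' := congrArg Complex.re t1
  have t2' := congrArg Complex.re t2
  simp [matInner_eq_of_isHermitian hC, matInner_eq_of_isHermitian hC', ← hD,
    Matrix.mul_assoc] at t1' t2' ⊢
  linarith

theorem exists_eq_matInner (φ : Matrix m n ℂ →L[ℝ] ℝ) : ∃ G, φ = matInner G := by
  classical
  refine ⟨Matrix.of fun i j => ⟨φ (Matrix.single i j 1), φ (Matrix.single i j Complex.I)⟩, ?_⟩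
  ext D
  have hD : D = ∑ i, ∑ j, ((D i j).re • Matrix.single i j (1 : ℂ) +
      (D i j).im • Matrix.single i j Complex.I) := by
    conv_lhs => rw [Matrix.matrix_eq_sum_single D]
    refine Finset.sum_congr rfl fun i _ => Finset.sum_congr rfl fun j _ => ?_
    rw [Matrix.smul_single, Matrix.smul_single, ← Matrix.single_add]
    congr 1
    apply Complex.ext <;> simp
  conv_lhs => rw [hD]
  rw [matInner_apply]
  simp only [map_sum, map_add, map_smul, Matrix.trace, Matrix.diag, Matrix.mul_apply,
    Complex.re_sum]
  rw [Finset.sum_comm]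
  refine Finset.sum_congr rfl fun i _ => Finset.sum_congr rfl fun j _ => ?_
  simp
  ring

theorem matInner_self_eq_zero {G : Matrix m n ℂ} (h : matInner G G = 0) : G = 0 := by
  have h0 := (Matrix.posSemidef_conjTranspose_mul_self G).trace_nonneg
  rw [← Matrix.trace_conjTranspose_mul_self_eq_zero_iff]
  rw [Complex.le_def] at h0
  exact Complex.ext h (by simpa using h0.2.symm)

theorem matInner_conjTranspose (G D : Matrix m n ℂ) : matInner Gᴴ Dᴴ = matInner G D := by
  rw [matInner_apply, matInner_apply, ← Matrix.conjTranspose_mul, Matrix.trace_conjTranspose,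
    Matrix.trace_mul_comm]
  simp

/-- Gradients on the space of Hermitian matrices are unique. -/
theorem HasHermGrad.eq_of_hasFDerivAt {f : Matrix n n ℂ → ℝ} {X G G' : Matrix n n ℂ}
    (h : HasHermGrad f X G) (hX : X.IsHermitian) (hG' : G'.IsHermitian)
    (h' : HasFDerivAt f (matInner G') X) : G = G' := by
  have hsub : (G - G').IsHermitian := h.1.sub hG'
  -- Both gradients are tested along the direction `G - G'`. The line stays inside the Hermitian
  -- matrices, so the derivative within that subspace suffices, and the outcome is that `G - G'` has
  -- norm zero.
  have hline : HasDerivAt (fun t : ℝ => X + t • (G - G')) (G - G') 0 := by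
    simpa using ((hasDerivAt_id (0 : ℝ)).smul_const (G - G')).const_add X
  have hX0 : X + (0 : ℝ) • (G - G') = X := by simp
  have hmaps : ∀ t : ℝ, X + t • (G - G') ∈ {Y : Matrix n n ℂ | Y.IsHermitian} := fun t =>
    hX.add (by
      change (t • (G - G'))ᴴ = _
      rw [Matrix.conjTranspose_smul, hsub.eq]; simp)
  have h1 : HasDerivAt (fun t : ℝ => f (X + t • (G - G'))) (matInner G (G - G')) 0 := by
    have := HasFDerivWithinAt.comp_hasDerivWithinAt (t := {Y : Matrix n n ℂ | Y.IsHermitian})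
      (s := Set.univ) (f := fun t : ℝ => X + t • (G - G')) (0 : ℝ) (by rw [hX0]; exact h.2)
      hline.hasDerivWithinAt (fun t _ => hmaps t)
    simpa [hasDerivWithinAt_univ, Function.comp_def] using this
  have h2 : HasDerivAt (fun t : ℝ => f (X + t • (G - G'))) (matInner G' (G - G')) 0 :=
    HasFDerivAt.comp_hasDerivAt (f := fun t : ℝ => X + t • (G - G')) (0 : ℝ) (by rw [hX0]; exact h')
      hline
  have h3 : matInner (G - G') (G - G') = 0 := by
    have := h1.unique h2
    rw [matInner_apply, Matrix.conjTranspose_sub, Matrix.sub_mul, Matrix.trace_sub, Complex.sub_re]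
    rw [matInner_apply, matInner_apply] at this
    linarith
  exact sub_eq_zero.1 (matInner_self_eq_zero h3)

end MatrixCalculus

/-! ## Polite water-filling on a single link -/

namespace Matrix

variable {m n : Type*} [Fintype m] [Fintype n] [DecidableEq m] [DecidableEq n]

open scoped MatrixOrder in
-- With `A = CᴴC` and `B = DᴴD`, the trace is the squared Frobenius norm of `C Dᴴ`.
theorem PosSemidef.mul_eq_zero_of_trace_mul_eq_zero {A B : Matrix n n ℂ} (hA : A.PosSemidef)
    (hB : B.PosSemidef) (h : (A * B).trace = 0) : A * B = 0 := by
  obtain ⟨C, rfl⟩ := CStarAlgebra.nonneg_iff_eq_star_mul_self.1 hA.nonneg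
  obtain ⟨D, rfl⟩ := CStarAlgebra.nonneg_iff_eq_star_mul_self.1 hB.nonneg
  have h1 : C * star D = 0 := by
    rw [← Matrix.trace_conjTranspose_mul_self_eq_zero_iff, ← h]
    rw [conjTranspose_mul, Matrix.mul_assoc, Matrix.trace_mul_comm]
    simp [star_eq_conjTranspose, Matrix.mul_assoc]
  rw [Matrix.mul_assoc, ← Matrix.mul_assoc C, h1]
  simp

theorem PosDef.isUnit_det {A : Matrix n n ℂ} (hA : A.PosDef) : IsUnit A.det :=
  (isUnit_iff_isUnit_det _).1 hA.isUnit

theorem PosSemidef.posDef_of_isUnit_det {A : Matrix n n ℂ} (hA : A.PosSemidef)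
    (h : IsUnit A.det) : A.PosDef :=
  hA.posDef_iff_det_ne_zero.2 h.ne_zero

theorem inv_sub_inv_eq_left {X Z : Matrix n n ℂ} (hX : IsUnit X.det) (hZ : IsUnit Z.det) :
    X⁻¹ - Z⁻¹ = X⁻¹ * (Z - X) * Z⁻¹ := by
  rw [Matrix.mul_sub, Matrix.sub_mul, nonsing_inv_mul _ hX, mul_nonsing_inv_cancel_right _ _ hZ,
    Matrix.one_mul]

theorem inv_sub_inv_eq_right {X Z : Matrix n n ℂ} (hX : IsUnit X.det) (hZ : IsUnit Z.det) :
    X⁻¹ - Z⁻¹ = Z⁻¹ * (Z - X) * X⁻¹ := by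
  rw [Matrix.mul_sub, Matrix.sub_mul, nonsing_inv_mul _ hZ, mul_nonsing_inv_cancel_right _ _ hX,
    Matrix.one_mul]

/-- The difference is a congruence of `K + K X⁻¹ K` by `(X + K)⁻¹`. -/
theorem PosDef.inv_sub_inv_add_posSemidef {X K : Matrix n n ℂ} (hX : X.PosDef)
    (hK : K.PosSemidef) : (X⁻¹ - (X + K)⁻¹).PosSemidef := by
  have hZ := hX.add_posSemidef hK
  have e : X⁻¹ - (X + K)⁻¹ = (X + K)⁻¹ * (K + K * X⁻¹ * K) * (X + K)⁻¹ := by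
    have : K + K * X⁻¹ * K = K * X⁻¹ * (X + K) := by
      rw [Matrix.mul_add, nonsing_inv_mul_cancel_right _ _ hX.isUnit_det]
    rw [this, inv_sub_inv_eq_right hX.isUnit_det hZ.isUnit_det, add_sub_cancel_left,
      ← Matrix.mul_assoc, mul_nonsing_inv_cancel_right _ _ hZ.isUnit_det, Matrix.mul_assoc]
  rw [e]
  have h1 : (K * X⁻¹ * K).PosSemidef := by
    have := hX.inv.posSemidef.mul_mul_conjTranspose_same K
    rwa [hK.isHermitian.eq] at this
  have h2 := (hK.add h1).mul_mul_conjTranspose_same (X + K)⁻¹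
  rwa [hZ.inv.isHermitian.eq] at h2

/-- The two matrices are the two Schur complements of the block matrix with diagonal blocks `Z`, `Y`
and off-diagonal block `√w H`; each is positive semidefinite exactly when the block matrix is. -/
theorem posSemidef_sub_smul_inv_comm {H : Matrix m n ℂ} {Y : Matrix n n ℂ} {Z : Matrix m m ℂ}
    (hY : Y.PosDef) (hZ : Z.PosDef) {w : ℝ} (hw : 0 ≤ w)
    (h : (Y - (w : ℂ) • (Hᴴ * Z⁻¹ * H)).PosSemidef) :
    (Z - (w : ℂ) • (H * Y⁻¹ * Hᴴ)).PosSemidef := by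
  have hs : ((Real.sqrt w : ℝ) : ℂ) * ((Real.sqrt w : ℝ) : ℂ) = (w : ℂ) := by
    rw [← Complex.ofReal_mul, Real.mul_self_sqrt hw]
  set B : Matrix m n ℂ := ((Real.sqrt w : ℝ) : ℂ) • H with hB
  have hBh : Bᴴ = ((Real.sqrt w : ℝ) : ℂ) • Hᴴ := by
    rw [hB, conjTranspose_smul]; simp
  have e1 : Bᴴ * Z⁻¹ * B = (w : ℂ) • (Hᴴ * Z⁻¹ * H) := by
    rw [hBh, hB, Matrix.smul_mul, Matrix.smul_mul, Matrix.mul_smul, smul_smul, hs]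
  have e2 : B * Y⁻¹ * Bᴴ = (w : ℂ) • (H * Y⁻¹ * Hᴴ) := by
    rw [hBh, hB, Matrix.smul_mul, Matrix.smul_mul, Matrix.mul_smul, smul_smul, hs]
  let := invertibleOfIsUnitDet _ hY.isUnit_det
  let := invertibleOfIsUnitDet _ hZ.isUnit_det
  rw [← e2, ← PosDef.fromBlocks₂₂ Z B hY, PosDef.fromBlocks₁₁ B Y hZ, e1]
  exact h

/-! ### Algebra of one link: `X`, `Y` are the forward and reverse interference-plus-noise
covariances, `S`, `T` the forward and reverse inputs. -/

section PoliteWaterFilling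

variable {H : Matrix m n ℂ} {X T : Matrix m m ℂ} {Y S : Matrix n n ℂ} {w : ℝ}

omit [DecidableEq n] in
theorem polite_mul_left (hX : X.PosDef) (hS : S.PosSemidef)
    (hT : T = (w : ℂ) • (X⁻¹ - (X + H * S * Hᴴ)⁻¹)) :
    (X + H * S * Hᴴ) * T = (w : ℂ) • (H * S * Hᴴ * X⁻¹) := by
  have hZ := hX.add_posSemidef (hS.mul_mul_conjTranspose_same H)
  rw [hT, inv_sub_inv_eq_right hX.isUnit_det hZ.isUnit_det, add_sub_cancel_left, Matrix.mul_smul,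
    Matrix.mul_assoc _ (H * S * Hᴴ), mul_nonsing_inv_cancel_left _ _ hZ.isUnit_det]

omit [DecidableEq n] in
theorem polite_mul_right (hX : X.PosDef) (hS : S.PosSemidef)
    (hT : T = (w : ℂ) • (X⁻¹ - (X + H * S * Hᴴ)⁻¹)) :
    T * X = (w : ℂ) • ((X + H * S * Hᴴ)⁻¹ * (H * S * Hᴴ)) := by
  have hZ := hX.add_posSemidef (hS.mul_mul_conjTranspose_same H)
  rw [hT, inv_sub_inv_eq_right hX.isUnit_det hZ.isUnit_det, add_sub_cancel_left, Matrix.smul_mul,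
    nonsing_inv_mul_cancel_right _ _ hX.isUnit_det]

omit [DecidableEq n] in
theorem polite_posSemidef (hX : X.PosDef) (hS : S.PosSemidef) (hw : 0 ≤ w)
    (hT : T = (w : ℂ) • (X⁻¹ - (X + H * S * Hᴴ)⁻¹)) : T.PosSemidef := by
  rw [hT]
  exact (hX.inv_sub_inv_add_posSemidef (hS.mul_mul_conjTranspose_same H)).smul
    (by exact_mod_cast hw)

variable (hX : X.PosDef) (hY : Y.PosDef) (hS : S.PosSemidef) (hw : 0 ≤ w)
  (hT : T = (w : ℂ) • (X⁻¹ - (X + H * S * Hᴴ)⁻¹))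
  (hle : (Y - (w : ℂ) • (Hᴴ * (X + H * S * Hᴴ)⁻¹ * H)).PosSemidef)
  (htr : (S * ((w : ℂ) • (Hᴴ * (X + H * S * Hᴴ)⁻¹ * H) - Y)).trace = 0)

-- Complementary slackness: a vanishing trace of a product of semidefinite matrices forces the
-- product itself to vanish.
include hS hle htr in
theorem kkt_mul_left : S * Y = (w : ℂ) • (S * (Hᴴ * (X + H * S * Hᴴ)⁻¹ * H)) := by
  have h : S * (Y - (w : ℂ) • (Hᴴ * (X + H * S * Hᴴ)⁻¹ * H)) = 0 := by
    apply hS.mul_eq_zero_of_trace_mul_eq_zero hle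
    rw [← neg_sub, Matrix.mul_neg, trace_neg, htr, neg_zero]
  rw [Matrix.mul_sub, Matrix.mul_smul] at h
  exact sub_eq_zero.1 h

include hX hY hS hle htr in
theorem kkt_mul_right : Y * S = (w : ℂ) • (Hᴴ * (X + H * S * Hᴴ)⁻¹ * H * S) := by
  have h := congrArg conjTranspose (kkt_mul_left hS hle htr)
  have hZ := (hX.add_posSemidef (hS.mul_mul_conjTranspose_same H)).inv.isHermitian.eq
  rw [conjTranspose_mul, hS.isHermitian.eq, hY.isHermitian.eq, conjTranspose_smul,
    conjTranspose_mul, conjTranspose_mul, conjTranspose_mul, hZ, hS.isHermitian.eq,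
    conjTranspose_conjTranspose] at h
  simpa [Matrix.mul_assoc] using h

include hX hS hT hle htr in
theorem polite_reverse_interference :
    Hᴴ * T * H = Hᴴ * X⁻¹ * H * S * Y := by
  have hZ := hX.add_posSemidef (hS.mul_mul_conjTranspose_same H)
  have h := kkt_mul_left hS hle htr
  rw [Matrix.mul_assoc _ S, h, hT, inv_sub_inv_eq_left hX.isUnit_det hZ.isUnit_det,
    add_sub_cancel_left]
  simp only [Matrix.mul_smul, Matrix.smul_mul, Matrix.mul_assoc]

omit [DecidableEq n] in
include hX hY hS hw hT in
theorem polite_reverse_posDef : (Y + Hᴴ * T * H).PosDef :=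
  hY.add_posSemidef ((polite_posSemidef hX hS hw hT).conjTranspose_mul_mul_same H)

-- The crux is `(Y + HᴴTH)(w Y⁻¹ - S) = w`: after substitution of `HᴴTH = HᴴX⁻¹HSY` and the KKT
-- identity for `Y S`, all other terms cancel. Inverting the first factor recovers `S` from `T`.
include hX hY hS hw hT hle htr in
theorem polite_involutive : (w : ℂ) • (Y⁻¹ - (Y + Hᴴ * T * H)⁻¹) = S := by
  have hY' := polite_reverse_posDef (H := H) hX hY hS hw hT
  have k1 := kkt_mul_right hX hY hS hle htr
  have k3 := polite_reverse_interference hX hS hT hle htr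
  have k4 : Hᴴ * T * H * S = (w : ℂ) • (Hᴴ * X⁻¹ * H * S) - Y * S := by
    rw [k1, hT]
    simp only [Matrix.mul_smul, Matrix.smul_mul, Matrix.mul_sub, Matrix.sub_mul, smul_sub]
  have k5 : (Y + Hᴴ * T * H) * ((w : ℂ) • Y⁻¹ - S) = (w : ℂ) • 1 := by
    rw [Matrix.mul_sub, Matrix.add_mul _ _ S, k4, Matrix.mul_smul, Matrix.add_mul, k3,
      mul_nonsing_inv_cancel_right _ _ hY.isUnit_det, mul_nonsing_inv _ hY.isUnit_det, smul_add]
    abel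
  have k6 : (w : ℂ) • Y⁻¹ - S = (w : ℂ) • (Y + Hᴴ * T * H)⁻¹ := by
    rw [← nonsing_inv_mul_cancel_left _ ((w : ℂ) • Y⁻¹ - S) hY'.isUnit_det, k5, Matrix.mul_smul,
      Matrix.mul_one]
  rw [smul_sub, ← k6, sub_sub_cancel]

-- Multiplying by `X + HSHᴴ` on the left and `Y + HᴴTH` on the right turns both sides into `w
-- HSHᴴX⁻¹H`. The identity later supplies the hypothesis of `hasFDerivAt_quadratic_sub`.
include hX hY hS hw hT hle htr in
theorem polite_mul_mul_inv :
    T * H * (Y + Hᴴ * T * H)⁻¹ = (X + H * S * Hᴴ)⁻¹ * H * S := by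
  have hY' := polite_reverse_posDef (H := H) hX hY hS hw hT
  have hZ := hX.add_posSemidef (hS.mul_mul_conjTranspose_same H)
  have k2 := kkt_mul_left hS hle htr
  have h1 : T * H = (X + H * S * Hᴴ)⁻¹ * H * S * (Y + Hᴴ * T * H) := by
    rw [← nonsing_inv_mul_cancel_left _ (T * H) hZ.isUnit_det, ← Matrix.mul_assoc _ T,
      polite_mul_left hX hS hT, Matrix.mul_assoc (_ * H), Matrix.mul_assoc _ H, Matrix.mul_add, k2,
      Matrix.mul_assoc]
    congr 1
    rw [hT]
    simp only [Matrix.mul_smul, Matrix.smul_mul, Matrix.mul_sub, Matrix.sub_mul, smul_sub,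
      Matrix.mul_add, Matrix.mul_assoc]
    abel
  rw [h1, mul_nonsing_inv_cancel_right _ _ hY'.isUnit_det]

-- Schur complement symmetry turns the forward bound into `X + HSHᴴ ⪰ w H Y⁻¹ Hᴴ`; expressing `S`
-- through `polite_involutive` replaces `Y` by `Y + HᴴTH` and removes `HSHᴴ`.
include hX hY hS hw hT hle htr in
theorem polite_reverse_le :
    (X - (w : ℂ) • (H * (Y + Hᴴ * T * H)⁻¹ * Hᴴ)).PosSemidef := by
  have hZ := hX.add_posSemidef (hS.mul_mul_conjTranspose_same H)
  have h := posSemidef_sub_smul_inv_comm hY hZ hw hle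
  have e := polite_involutive hX hY hS hw hT hle htr
  have e2 : X + H * S * Hᴴ - (w : ℂ) • (H * Y⁻¹ * Hᴴ) =
      X - (w : ℂ) • (H * (Y + Hᴴ * T * H)⁻¹ * Hᴴ) := by
    nth_rw 1 [← e]
    simp only [Matrix.mul_smul, Matrix.smul_mul, Matrix.mul_sub, Matrix.sub_mul, smul_sub]
    abel
  rwa [e2] at h

include hX hY hS hw hT hle htr in
theorem polite_reverse_mul_eq_zero :
    T * ((w : ℂ) • (H * (Y + Hᴴ * T * H)⁻¹ * Hᴴ) - X) = 0 := by
  rw [Matrix.mul_sub, polite_mul_right hX hS hT, Matrix.mul_smul, ← Matrix.mul_assoc,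
    ← Matrix.mul_assoc, polite_mul_mul_inv hX hY hS hw hT hle htr]
  simp only [Matrix.mul_assoc, sub_self]

end PoliteWaterFilling

end Matrix

/-! ## The Lagrangian of a one-hop network and its dual -/

section MatInner

variable {m n : Type*} [Fintype m] [Fintype n]

theorem matInner_comm (A B : Matrix m n ℂ) : matInner A B = matInner B A := by
  rw [matInner_apply, matInner_apply, ← Complex.conj_re, starRingEnd_apply,
    ← Matrix.trace_conjTranspose, Matrix.conjTranspose_mul,
    Matrix.conjTranspose_conjTranspose]

theorem matInner_add_left (A B D : Matrix m n ℂ) :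
    matInner (A + B) D = matInner A D + matInner B D := by
  simp [matInner_comm _ D]

theorem matInner_sub_left (A B D : Matrix m n ℂ) :
    matInner (A - B) D = matInner A D - matInner B D := by
  simp [matInner_comm _ D]

theorem matInner_sum_left {ι : Type*} (s : Finset ι) (A : ι → Matrix m n ℂ) (D : Matrix m n ℂ) :
    matInner (∑ i ∈ s, A i) D = ∑ i ∈ s, matInner (A i) D := by
  simp [matInner_comm _ D]

theorem matInner_smul_right (c : ℝ) (A D : Matrix m n ℂ) :
    matInner A ((c : ℂ) • D) = c * matInner A D := by
  rw [matInner_apply, Matrix.mul_smul, Matrix.trace_smul, matInner_apply]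
  simp

theorem matInner_smul_left (c : ℝ) (A D : Matrix m n ℂ) :
    matInner ((c : ℂ) • A) D = c * matInner A D := by
  rw [matInner_comm, matInner_smul_right, matInner_comm]

theorem matInner_congruence (H : Matrix m n ℂ) (G : Matrix m m ℂ) (D : Matrix n n ℂ) :
    matInner (Hᴴ * G * H) D = matInner G (H * D * Hᴴ) := by
  rw [matInner_apply, matInner_apply, Matrix.conjTranspose_mul, Matrix.conjTranspose_mul,
    Matrix.conjTranspose_conjTranspose, Matrix.mul_assoc, Matrix.trace_mul_comm]
  simp only [Matrix.mul_assoc]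

end MatInner

namespace IFN

variable {L : ℕ} {tx rx : Fin L → ℕ} (N : IFN L tx rx)
  (S : ∀ l, Matrix (Fin (tx l)) (Fin (tx l)) ℂ) (w : Fin L → ℝ)

/-- The dual network, with reversed links and the roles of noise and constraints exchanged. -/
def dual : IFN L rx tx where
  Φ := N.Φᵀ
  H := fun l k => (N.H k l)ᴴ
  W := N.What
  What := N.W

@[simp] theorem dual_dual : N.dual.dual = N := by
  simp [dual]

/-- Covariance of the desired signal at receiver `l`. -/
noncomputable def signal (l : Fin L) : Matrix (Fin (rx l)) (Fin (rx l)) ℂ :=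
  N.H l l * S l * (N.H l l)ᴴ

/-- Covariance of the received signal, noise included. -/
noncomputable def totalCov (l : Fin L) : Matrix (Fin (rx l)) (Fin (rx l)) ℂ :=
  N.Omega S l + N.signal S l

/-- `w_l (Ω_l⁻¹ - (Ω_l + H_{l,l} Σ_l H_{l,l}ᴴ)⁻¹)`. -/
noncomputable def politeDual (l : Fin L) : Matrix (Fin (rx l)) (Fin (rx l)) ℂ :=
  (w l : ℂ) • ((N.Omega S l)⁻¹ - (N.totalCov S l)⁻¹)

/-- The Lagrangian of the one-hop network. -/
noncomputable def lag : ℝ :=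
  (∑ l, w l * N.rate S l) - ∑ l, (S l * N.What l).trace.re

/-- The gradient of the Lagrangian with respect to the `l`-th covariance. -/
noncomputable def lagGrad (l : Fin L) : Matrix (Fin (tx l)) (Fin (tx l)) ℂ :=
  (w l : ℂ) • ((N.H l l)ᴴ * (N.totalCov S l)⁻¹ * N.H l l) - N.dual.Omega (N.politeDual S w) l

/-- Each coupling term `φ_{l,k} Tr(T_l H_{l,k} S_k H_{l,k}ᴴ)` may be charged to receiver `l` or to
transmitter `k`. The identity is exact for arbitrary `S` and `T`, so it survives differentiation in
any parameter. -/
theorem sum_matInner_Omega (T : ∀ l, Matrix (Fin (rx l)) (Fin (rx l)) ℂ) :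
    ∑ l, matInner (T l) (N.Omega S l) + ∑ l, matInner (N.What l) (S l) =
      ∑ l, matInner (N.dual.Omega T l) (S l) + ∑ l, matInner (T l) (N.W l) := by
  simp only [Omega, dual, map_add, map_sum, matInner_add_left, matInner_sum_left,
    matInner_smul_left, matInner_smul_right, Finset.sum_add_distrib, Matrix.transpose_apply,
    Matrix.conjTranspose_conjTranspose, matInner_congruence]
  rw [Finset.sum_comm]
  ring

variable {N S w}

theorem Omega_posSemidef (hΦ : ∀ l k, 0 ≤ N.Φ l k) (hW : ∀ l, (N.W l).PosSemidef)
    (hS : ∀ l, (S l).PosSemidef) (l : Fin L) : (N.Omega S l).PosSemidef :=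
  (hW l).add (Matrix.posSemidef_sum _ fun k _ =>
    ((hS k).mul_mul_conjTranspose_same (N.H l k)).smul (by exact_mod_cast hΦ l k))

theorem Omega_posDef (hΦ : ∀ l k, 0 ≤ N.Φ l k) (hW : ∀ l, (N.W l).PosDef)
    (hS : ∀ l, (S l).PosSemidef) (l : Fin L) : (N.Omega S l).PosDef :=
  (hW l).add_posSemidef (Matrix.posSemidef_sum _ fun k _ =>
    ((hS k).mul_mul_conjTranspose_same (N.H l k)).smul (by exact_mod_cast hΦ l k))

theorem signal_posSemidef (hS : ∀ l, (S l).PosSemidef) (l : Fin L) :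
    (N.signal S l).PosSemidef :=
  (hS l).mul_mul_conjTranspose_same (N.H l l)

theorem totalCov_posDef (hS : ∀ l, (S l).PosSemidef) (hO : ∀ l, (N.Omega S l).PosDef)
    (l : Fin L) : (N.totalCov S l).PosDef :=
  (hO l).add_posSemidef (signal_posSemidef hS l)

theorem politeDual_posSemidef (hS : ∀ l, (S l).PosSemidef) (hO : ∀ l, (N.Omega S l).PosDef)
    (hw : ∀ l, 0 ≤ w l) (l : Fin L) : (N.politeDual S w l).PosSemidef :=
  polite_posSemidef (hO l) (hS l) (hw l) rfl

theorem Omega_isHermitian (hW : ∀ l, (N.W l).IsHermitian) (hS : ∀ l, (S l).IsHermitian)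
    (l : Fin L) : (N.Omega S l).IsHermitian := by
  rw [Matrix.IsHermitian, Omega, Matrix.conjTranspose_add, (hW l).eq, Matrix.conjTranspose_sum]
  congr 1
  refine Finset.sum_congr rfl fun k _ => ?_
  simp [Matrix.conjTranspose_mul, (hS k).eq, Matrix.mul_assoc]

theorem lagGrad_isHermitian (hS : ∀ l, (S l).PosSemidef) (hO : ∀ l, (N.Omega S l).PosDef)
    (hw : ∀ l, 0 ≤ w l) (hWhat : ∀ l, (N.What l).IsHermitian) (l : Fin L) :
    (N.lagGrad S w l).IsHermitian := by
  refine Matrix.IsHermitian.sub ?_ (Omega_isHermitian (N := N.dual) hWhat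
    (fun l => (politeDual_posSemidef hS hO hw l).isHermitian) l)
  exact (((totalCov_posDef hS hO l).inv.posSemidef.conjTranspose_mul_mul_same (N.H l l)).smul
    (by exact_mod_cast hw l : (0 : ℂ) ≤ w l)).isHermitian

/-! ### First-order expansions of one-hop Lagrangians. -/

section Calculus

attribute [local instance] Matrix.supNormedAddCommGroup Matrix.supNormedSpace

variable {E : Type*} [NormedAddCommGroup E] [NormedSpace ℝ E]

theorem differentiableAt_signal {𝒩 : E → IFN L tx rx}
    {𝒮 : E → ∀ l, Matrix (Fin (tx l)) (Fin (tx l)) ℂ} {x : E}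
    (hH : ∀ l k, DifferentiableAt ℝ (fun y => (𝒩 y).H l k) x)
    (hS : ∀ l, DifferentiableAt ℝ (fun y => 𝒮 y l) x) (l : Fin L) :
    DifferentiableAt ℝ (fun y => (𝒩 y).signal (𝒮 y) l) x :=
  ((hH l l).matrix_mul (hS l)).matrix_mul (hH l l).matrix_conjTranspose

theorem differentiableAt_Omega {𝒩 : E → IFN L tx rx}
    {𝒮 : E → ∀ l, Matrix (Fin (tx l)) (Fin (tx l)) ℂ} {x : E} {Φ : Matrix (Fin L) (Fin L) ℝ}
    (hΦ : ∀ y, (𝒩 y).Φ = Φ)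
    (hH : ∀ l k, DifferentiableAt ℝ (fun y => (𝒩 y).H l k) x)
    (hW : ∀ l, DifferentiableAt ℝ (fun y => (𝒩 y).W l) x)
    (hS : ∀ l, DifferentiableAt ℝ (fun y => 𝒮 y l) x) (l : Fin L) :
    DifferentiableAt ℝ (fun y => (𝒩 y).Omega (𝒮 y) l) x := by
  simp only [Omega, hΦ]
  refine (hW l).fun_add (DifferentiableAt.fun_sum fun k _ => ?_)
  exact (((hH l k).matrix_mul (hS k)).matrix_mul (hH l k).matrix_conjTranspose).const_smul
    ((Φ l k : ℝ) : ℂ)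

/-- First-order expansion of the weighted sum rate. -/
theorem hasFDerivAt_sum_rate_sub {𝒩 : E → IFN L tx rx}
    {𝒮 : E → ∀ l, Matrix (Fin (tx l)) (Fin (tx l)) ℂ} {x : E} {Φ : Matrix (Fin L) (Fin L) ℝ}
    (hΦ : ∀ y, (𝒩 y).Φ = Φ)
    (hH : ∀ l k, DifferentiableAt ℝ (fun y => (𝒩 y).H l k) x)
    (hW : ∀ l, DifferentiableAt ℝ (fun y => (𝒩 y).W l) x)
    (hS : ∀ l, DifferentiableAt ℝ (fun y => 𝒮 y l) x)
    (pS : ∀ l, (𝒮 x l).PosSemidef) (pO : ∀ l, ((𝒩 x).Omega (𝒮 x) l).PosDef) :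
    HasFDerivAt (fun y => (∑ l, w l * (𝒩 y).rate (𝒮 y) l) -
      ((∑ l, matInner ((w l : ℂ) • ((𝒩 x).totalCov (𝒮 x) l)⁻¹) ((𝒩 y).signal (𝒮 y) l)) -
        ∑ l, matInner ((𝒩 x).politeDual (𝒮 x) w l) ((𝒩 y).Omega (𝒮 y) l)))
      (0 : E →L[ℝ] ℝ) x := by
  have h := HasFDerivAt.fun_sum (u := Finset.univ) (x := x) fun l _ =>
    (hasFDerivAt_log_det_sub (differentiableAt_signal (𝒩 := 𝒩) (𝒮 := 𝒮) hH hS l)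
      (differentiableAt_Omega hΦ hH hW hS l) (signal_posSemidef pS l) (pO l)).const_mul (w l)
  refine (h.congr_fderiv (by simp)).congr_of_eventuallyEq (Filter.Eventually.of_forall fun y => ?_)
  simp only [← Finset.sum_sub_distrib]
  refine Finset.sum_congr rfl fun l _ => ?_
  rw [politeDual, matInner_smul_left, matInner_smul_left, matInner_sub_left, map_add]
  simp only [rate, totalCov, signal]
  ring

theorem differentiableAt_lag {𝒩 : E → IFN L tx rx} {x : E} {Φ : Matrix (Fin L) (Fin L) ℝ}
    (hΦ : ∀ y, (𝒩 y).Φ = Φ)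
    (hH : ∀ l k, DifferentiableAt ℝ (fun y => (𝒩 y).H l k) x)
    (hW : ∀ l, DifferentiableAt ℝ (fun y => (𝒩 y).W l) x)
    (hWhat : ∀ l, DifferentiableAt ℝ (fun y => (𝒩 y).What l) x)
    (hS : ∀ l, (S l).PosSemidef) (hO : ∀ l, ((𝒩 x).Omega S l).PosDef) :
    DifferentiableAt ℝ (fun y => (𝒩 y).lag S w) x := by
  have hc : ∀ l, DifferentiableAt ℝ (fun _ : E => S l) x := fun _ => differentiableAt_const _
  have h := (hasFDerivAt_sum_rate_sub (w := w) hΦ hH hW hc hS hO).differentiableAt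
  have h1 : DifferentiableAt ℝ (fun y =>
      (∑ l, matInner ((w l : ℂ) • ((𝒩 x).totalCov S l)⁻¹) ((𝒩 y).signal S l)) -
        ∑ l, matInner ((𝒩 x).politeDual S w l) ((𝒩 y).Omega S l)) x :=
    (DifferentiableAt.fun_sum fun l _ => (differentiableAt_signal hH hc l).matInner_comp _).sub
      (DifferentiableAt.fun_sum fun l _ => (differentiableAt_Omega hΦ hH hW hc l).matInner_comp _)
  have h2 : DifferentiableAt ℝ (fun y => ∑ l, (S l * (𝒩 y).What l).trace.re) x := by
    refine DifferentiableAt.fun_sum fun l _ => ?_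
    have := (hWhat l).matInner_comp (S l)
    simpa only [matInner_eq_of_isHermitian (hS l).isHermitian] using this
  refine ((h.add h1).sub h2).congr_of_eventuallyEq (Filter.Eventually.of_forall fun y => ?_)
  simp only [lag, Pi.add_apply, Pi.sub_apply]
  ring

theorem differentiableAt_update_apply {ι : Type*} [Fintype ι] [DecidableEq ι] {a b : ι → Type*}
    [∀ i, Fintype (a i)] [∀ i, Fintype (b i)] (S : ∀ i, Matrix (a i) (b i) ℂ) (i j : ι)
    (X : Matrix (a i) (b i) ℂ) :
    DifferentiableAt ℝ (fun Y => Function.update S i Y j) X :=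
  differentiableAt_pi.1 (hasFDerivAt_update (𝕜 := ℝ) S X).differentiableAt j

theorem hasFDerivAt_lag (hS : ∀ l, (S l).PosSemidef) (hO : ∀ l, (N.Omega S l).PosDef)
    (hWhat : ∀ l, (N.What l).IsHermitian) (l : Fin L) :
    HasFDerivAt (fun X => N.lag (Function.update S l X) w) (matInner (N.lagGrad S w l)) (S l) := by
  have h := hasFDerivAt_sum_rate_sub (w := w) (𝒩 := fun _ => N)
    (𝒮 := fun X => Function.update S l X) (x := S l) (Φ := N.Φ) (fun _ => rfl)
    (fun _ _ => differentiableAt_const _) (fun _ => differentiableAt_const _)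
    (fun k => differentiableAt_update_apply S l k _)
    (by simpa using hS) (by simpa using hO)
  simp only [Function.update_eq_self] at h
  -- The linearized Lagrangian is affine in the covariances once the interference is regrouped by
  -- transmitter, and its coefficients are the matrices `lagGrad`.
  have key : ∀ S' : ∀ l, Matrix (Fin (tx l)) (Fin (tx l)) ℂ,
      (∑ l, matInner ((w l : ℂ) • (N.totalCov S l)⁻¹) (N.signal S' l)) -
        (∑ l, matInner (N.politeDual S w l) (N.Omega S' l)) - ∑ l, (S' l * N.What l).trace.re =
      (∑ l, matInner (N.lagGrad S w l) (S' l)) - ∑ l, matInner (N.politeDual S w l) (N.W l) := by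
    intro S'
    have h1 := N.sum_matInner_Omega S' (N.politeDual S w)
    have h2 : ∀ l, (S' l * N.What l).trace.re = matInner (N.What l) (S' l) := fun l => by
      rw [matInner_eq_of_isHermitian (hWhat l), Matrix.trace_mul_comm]
    have h3 : ∀ l, matInner ((w l : ℂ) • (N.totalCov S l)⁻¹) (N.signal S' l) =
        matInner ((w l : ℂ) • ((N.H l l)ᴴ * (N.totalCov S l)⁻¹ * N.H l l)) (S' l) := fun l => by
      rw [matInner_smul_left, matInner_smul_left, matInner_congruence, signal]
    simp only [h2, h3, lagGrad, matInner_sub_left, Finset.sum_sub_distrib]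
    linarith
  have hlin : HasFDerivAt (fun X => (∑ k, matInner (N.lagGrad S w k) (Function.update S l X k)) -
      ∑ k, matInner (N.politeDual S w k) (N.W k)) (matInner (N.lagGrad S w l)) (S l) := by
    have e : ∀ X, (∑ k, matInner (N.lagGrad S w k) (Function.update S l X k)) =
        matInner (N.lagGrad S w l) X +
          ∑ k ∈ Finset.univ.erase l, matInner (N.lagGrad S w k) (S k) := fun X => by
      rw [← Finset.add_sum_erase _ _ (Finset.mem_univ l), Function.update_self]
      congr 1
      exact Finset.sum_congr rfl fun k hk => by
        rw [Function.update_of_ne (Finset.ne_of_mem_erase hk)]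
    simp only [e]
    exact ((matInner (N.lagGrad S w l)).hasFDerivAt.add_const _).sub_const _
  refine ((h.add hlin).congr_fderiv (zero_add _)).congr_of_eventuallyEq
    (Filter.Eventually.of_forall fun X => ?_)
  simp only [lag, ← key, Pi.add_apply]
  ring

/-- If the channels, noise and constraint matrices depend on a parameter, then the Lagrangians of
the network and of its dual have the same derivative at polite water-filling points. -/
theorem hasFDerivAt_lag_sub_dual {𝒩 : E → IFN L tx rx} {x : E}
    {Φ : Matrix (Fin L) (Fin L) ℝ} {T : ∀ l, Matrix (Fin (rx l)) (Fin (rx l)) ℂ}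
    (hΦ : ∀ y, (𝒩 y).Φ = Φ)
    (hH : ∀ l k, DifferentiableAt ℝ (fun y => (𝒩 y).H l k) x)
    (hW : ∀ l, DifferentiableAt ℝ (fun y => (𝒩 y).W l) x)
    (hWhat : ∀ l, DifferentiableAt ℝ (fun y => (𝒩 y).What l) x)
    (hS : ∀ l, (S l).PosSemidef) (hT : ∀ l, (T l).PosSemidef)
    (hO : ∀ l, ((𝒩 x).Omega S l).PosDef) (hO' : ∀ l, ((𝒩 x).dual.Omega T l).PosDef)
    (eT : ∀ l, (𝒩 x).politeDual S w l = T l) (eS : ∀ l, (𝒩 x).dual.politeDual T w l = S l)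
    (e : ∀ l, S l * ((𝒩 x).H l l)ᴴ * ((𝒩 x).totalCov S l)⁻¹ =
      ((𝒩 x).dual.totalCov T l)⁻¹ * ((𝒩 x).H l l)ᴴ * T l) :
    HasFDerivAt (fun y => (𝒩 y).lag S w - (𝒩 y).dual.lag T w) (0 : E →L[ℝ] ℝ) x := by
  have h1 := hasFDerivAt_sum_rate_sub (w := w) (𝒮 := fun _ => S) hΦ hH hW
    (fun _ => differentiableAt_const _) hS hO
  have h2 := hasFDerivAt_sum_rate_sub (w := w) (𝒩 := fun y => (𝒩 y).dual) (𝒮 := fun _ => T)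
    (Φ := Φᵀ) (fun y => by simp [dual, hΦ]) (fun l k => (hH k l).matrix_conjTranspose) hWhat
    (fun _ => differentiableAt_const _) hT hO'
  -- Linearizing the rates leaves the desired-signal traces, which cancel in pairs only to first
  -- order, by `e`.
  have h3 := HasFDerivAt.fun_sum (u := Finset.univ) (x := x) fun l _ =>
    (hasFDerivAt_quadratic_sub (hH l l) (totalCov_posDef hS hO l).inv.isHermitian
      (totalCov_posDef hT hO' l).inv.isHermitian (hS l).isHermitian (hT l).isHermitian
      (e l)).const_mul (w l)
  refine ((h1.sub h2).add h3 |>.congr_fderiv (by simp)).congr_of_eventuallyEq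
    (Filter.Eventually.of_forall fun y => ?_)
  -- All interference, noise and cost terms cancel exactly, for every `y`.
  have k1 := (𝒩 y).sum_matInner_Omega S T
  have k2 : ∀ l, (S l * (𝒩 y).What l).trace.re = matInner ((𝒩 y).What l) (S l) := fun l => by
    rw [matInner_comm, matInner_eq_of_isHermitian (hS l).isHermitian]
  have k3 : ∀ l, (T l * (𝒩 y).dual.What l).trace.re = matInner (T l) ((𝒩 y).W l) := fun l => by
    rw [matInner_eq_of_isHermitian (hT l).isHermitian]; rfl
  have k4 : ∀ l, matInner (S l) ((𝒩 y).dual.Omega T l) = matInner ((𝒩 y).dual.Omega T l) (S l) :=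
    fun l => matInner_comm _ _
  simp only [lag, eT, eS, k2, k3, k4, Pi.add_apply, Pi.sub_apply, matInner_smul_left,
    mul_sub, Finset.sum_sub_distrib]
  simp only [signal, dual, Matrix.conjTranspose_conjTranspose] at k1 ⊢
  linarith

end Calculus

end IFN

/-! ## The covariance transformation at polite water-filling points -/

namespace Matrix

variable {m n : Type*} [Fintype m] [Fintype n]

/-- The real part of the quadratic form `xᴴ A x`. -/
noncomputable def quadRe (A : Matrix n n ℂ) (x : n → ℂ) : ℝ := (star x ⬝ᵥ (A *ᵥ x)).re

theorem quadRe_add (A B : Matrix n n ℂ) (x : n → ℂ) :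
    quadRe (A + B) x = quadRe A x + quadRe B x := by
  simp [quadRe, Matrix.add_mulVec]

theorem quadRe_sub (A B : Matrix n n ℂ) (x : n → ℂ) :
    quadRe (A - B) x = quadRe A x - quadRe B x := by
  simp [quadRe, Matrix.sub_mulVec]

theorem quadRe_smul (c : ℝ) (A : Matrix n n ℂ) (x : n → ℂ) :
    quadRe ((c : ℂ) • A) x = c * quadRe A x := by
  simp [quadRe, Matrix.smul_mulVec]

theorem quadRe_zero (x : n → ℂ) : quadRe (0 : Matrix n n ℂ) x = 0 := by
  simp [quadRe]

theorem quadRe_sum {ι : Type*} (s : Finset ι) (A : ι → Matrix n n ℂ) (x : n → ℂ) :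
    quadRe (∑ i ∈ s, A i) x = ∑ i ∈ s, quadRe (A i) x := by
  classical
  induction s using Finset.induction_on with
  | empty => simp [quadRe_zero]
  | insert a s ha ih => rw [Finset.sum_insert ha, Finset.sum_insert ha, quadRe_add, ih]

theorem quadRe_congruence (H : Matrix m n ℂ) (A : Matrix n n ℂ) (x : m → ℂ) :
    quadRe (H * A * Hᴴ) x = quadRe A (Hᴴ *ᵥ x) := by
  rw [quadRe, quadRe, star_mulVec, conjTranspose_conjTranspose, ← mulVec_mulVec, ← mulVec_mulVec,
    ← dotProduct_mulVec]

theorem star_dotProduct_eq_star (v x : n → ℂ) : star x ⬝ᵥ v = star (star v ⬝ᵥ x) := by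
  rw [← star_dotProduct_star, star_star]

theorem quadRe_vecMulVec (v x : n → ℂ) :
    quadRe (vecMulVec v (star v)) x = ‖star v ⬝ᵥ x‖ ^ 2 := by
  rw [quadRe, vecMulVec_mulVec]
  simp only [op_smul_eq_smul, dotProduct_smul, smul_eq_mul]
  rw [star_dotProduct_eq_star v x, ← Complex.normSq_eq_norm_sq]
  exact congrArg Complex.re (Complex.mul_conj _)

theorem quadRe_smul_vec (c : ℝ) (A : Matrix n n ℂ) (x : n → ℂ) :
    quadRe A ((c : ℂ) • x) = c ^ 2 * quadRe A x := by
  simp [quadRe, mulVec_smul]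
  ring

theorem PosDef.quadRe_pos {A : Matrix n n ℂ} (hA : A.PosDef) {x : n → ℂ} (hx : x ≠ 0) :
    0 < quadRe A x := hA.re_dotProduct_pos hx

theorem PosSemidef.quadRe_nonneg {A : Matrix n n ℂ} (hA : A.PosSemidef) (x : n → ℂ) :
    0 ≤ quadRe A x := hA.re_dotProduct_nonneg x

theorem IsHermitian.coe_quadRe {A : Matrix n n ℂ} (hA : A.IsHermitian) (x : n → ℂ) :
    (quadRe A x : ℂ) = star x ⬝ᵥ (A *ᵥ x) := by
  apply Complex.conj_eq_iff_re.1
  rw [starRingEnd_apply, ← star_dotProduct_eq_star, star_mulVec, hA.eq, dotProduct_mulVec]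

theorem trace_vecMulVec_mul (v : n → ℂ) (A : Matrix n n ℂ) :
    (vecMulVec v (star v) * A).trace = star v ⬝ᵥ (A *ᵥ v) := by
  rw [Matrix.trace_mul_comm, mul_vecMulVec, trace_vecMulVec, dotProduct_comm]

section RankOne

variable [DecidableEq n]

/-- The Sherman-Morrison formula for a Hermitian rank-one update. -/
theorem PosDef.inv_sub_inv_add_rankOne {C : Matrix n n ℂ} (hC : C.PosDef) (u : n → ℂ) {p : ℝ}
    (hp : 0 ≤ p) :
    C⁻¹ - (C + (p : ℂ) • vecMulVec u (star u))⁻¹ =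
      ((p / (1 + p * quadRe C⁻¹ u) : ℝ) : ℂ) •
        vecMulVec (C⁻¹ *ᵥ u) (star (C⁻¹ *ᵥ u)) := by
  have hD : (C + (p : ℂ) • vecMulVec u (star u)).PosDef :=
    hC.add_posSemidef ((posSemidef_vecMulVec_self_star u).smul (by exact_mod_cast hp))
  have hg := hC.inv.posSemidef.quadRe_nonneg u
  have hpos : (1 + p * quadRe C⁻¹ u) ≠ 0 := by positivity
  have h1 : star u ᵥ* C⁻¹ ᵥ* (C + (p : ℂ) • vecMulVec u (star u)) =
      ((1 + p * quadRe C⁻¹ u : ℝ) : ℂ) • star u := by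
    rw [vecMul_add, vecMul_vecMul, nonsing_inv_mul _ hC.isUnit_det, vecMul_one, vecMul_smul,
      vecMul_vecMulVec, ← dotProduct_mulVec, ← hC.inv.isHermitian.coe_quadRe]
    ext i
    simp
    ring
  have h2 : star u ᵥ* (C + (p : ℂ) • vecMulVec u (star u))⁻¹ =
      (((1 + p * quadRe C⁻¹ u)⁻¹ : ℝ) : ℂ) • (star u ᵥ* C⁻¹) := by
    have h3 : star u = (((1 + p * quadRe C⁻¹ u)⁻¹ : ℝ) : ℂ) •
        (star u ᵥ* C⁻¹ ᵥ* (C + (p : ℂ) • vecMulVec u (star u))) := by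
      rw [h1, smul_smul, ← Complex.ofReal_mul, inv_mul_cancel₀ hpos, Complex.ofReal_one, one_smul]
    have h4 := congrArg (· ᵥ* (C + (p : ℂ) • vecMulVec u (star u))⁻¹) h3
    rwa [smul_vecMul, vecMul_vecMul _ (C + _), mul_nonsing_inv _ hD.isUnit_det, vecMul_one] at h4
  rw [inv_sub_inv_eq_left hC.isUnit_det hD.isUnit_det, add_sub_cancel_left, Matrix.mul_smul,
    mul_vecMulVec, Matrix.smul_mul, vecMulVec_mul, h2, star_mulVec, hC.inv.isHermitian.eq,
    vecMulVec_smul, smul_smul, div_eq_mul_inv, Complex.ofReal_mul]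

theorem PosDef.quadRe_inv_add_rankOne {C : Matrix n n ℂ} (hC : C.PosDef) (u : n → ℂ) {p : ℝ}
    (hp : 0 ≤ p) :
    quadRe (C + (p : ℂ) • vecMulVec u (star u))⁻¹ u =
      quadRe C⁻¹ u / (1 + p * quadRe C⁻¹ u) := by
  have hg := hC.inv.posSemidef.quadRe_nonneg u
  have hpos : (1 + p * quadRe C⁻¹ u) ≠ 0 := by positivity
  have h := congrArg (fun A => quadRe A u) (hC.inv_sub_inv_add_rankOne u hp)
  simp only [quadRe_sub, quadRe_smul, quadRe_vecMulVec] at h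
  rw [star_mulVec, hC.inv.isHermitian.eq, ← dotProduct_mulVec, ← hC.inv.isHermitian.coe_quadRe,
    Complex.norm_real, Real.norm_eq_abs, sq_abs] at h
  have : quadRe (C + (p : ℂ) • vecMulVec u (star u))⁻¹ u = quadRe C⁻¹ u -
      p / (1 + p * quadRe C⁻¹ u) * quadRe C⁻¹ u ^ 2 := by linarith
  rw [this]
  field_simp
  ring

end RankOne

/-- A matrix with nonpositive off-diagonal entries that maps some positive vector to a positive
vector is nonsingular. -/
theorem det_ne_zero_of_mulVec_pos [DecidableEq n] {A : Matrix n n ℝ} {q : n → ℝ}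
    (hA : ∀ i j, i ≠ j → A i j ≤ 0) (hq : ∀ i, 0 < q i) (h : ∀ i, 0 < (A *ᵥ q) i) :
    A.det ≠ 0 := by
  -- Scaling the columns by `q` makes the matrix strictly diagonally dominant by rows: the row sums
  -- are the entries of `A *ᵥ q`.
  have h1 : (A * diagonal q).det ≠ 0 := by
    apply det_ne_zero_of_sum_row_lt_diag
    intro i
    have e : ∀ j ∈ Finset.univ.erase i, ‖(A * diagonal q) i j‖ = -(A i j * q j) := fun j hj => by
      rw [mul_diagonal, Real.norm_of_nonpos]
      exact mul_nonpos_of_nonpos_of_nonneg (hA _ _ (Finset.ne_of_mem_erase hj).symm) (hq _).le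
    have hi := h i
    rw [mulVec, dotProduct, ← Finset.add_sum_erase _ _ (Finset.mem_univ i)] at hi
    rw [Finset.sum_congr rfl e, Finset.sum_neg_distrib, mul_diagonal]
    exact lt_of_lt_of_le (by linarith) (le_abs_self _)
  rw [det_mul] at h1
  exact left_ne_zero_of_mul h1

/-- Sum of the rank-one terms with index at least `k`, plus `X`. -/
noncomputable def tailCov {M : ℕ} (X : Matrix n n ℂ) (p : Fin M → ℝ) (u : Fin M → n → ℂ) (k : ℕ) :
    Matrix n n ℂ :=
  (∑ i : Fin M, if k ≤ (i : ℕ) then (p i : ℂ) • vecMulVec (u i) (star (u i)) else 0) + X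

section TailCov

variable {M : ℕ} {X : Matrix n n ℂ} {p : Fin M → ℝ} {u : Fin M → n → ℂ}

omit [Fintype n] in
theorem tailCov_zero :
    tailCov X p u 0 = (∑ i, (p i : ℂ) • vecMulVec (u i) (star (u i))) + X := by
  simp [tailCov]

omit [Fintype n] in
theorem tailCov_length : tailCov X p u M = X := by
  rw [tailCov, Finset.sum_eq_zero fun i _ => if_neg (by omega), zero_add]

omit [Fintype n] in
theorem tailCov_succ (i : Fin M) :
    tailCov X p u (i + 1) =
      (∑ j ∈ Finset.Ioi i, (p j : ℂ) • vecMulVec (u j) (star (u j))) + X := by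
  rw [tailCov, ← Finset.sum_filter]
  congr 2
  ext j
  simp only [Finset.mem_filter, Finset.mem_univ, true_and, Finset.mem_Ioi]
  exact Nat.succ_le_iff

omit [Fintype n] in
theorem tailCov_eq_succ_add (i : Fin M) :
    tailCov X p u i = tailCov X p u (i + 1) + (p i : ℂ) • vecMulVec (u i) (star (u i)) := by
  have h : (Finset.univ.filter fun j : Fin M => (i : ℕ) ≤ j) = insert i (Finset.Ioi i) := by
    ext j
    simp only [Finset.mem_filter, Finset.mem_univ, true_and, Finset.mem_insert, Finset.mem_Ioi]
    omega
  rw [tailCov_succ, tailCov, ← Finset.sum_filter, h, Finset.sum_insert (by simp)]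
  abel

theorem tailCov_posDef (hX : X.PosDef) (hp : ∀ i, 0 < p i) (k : ℕ) : (tailCov X p u k).PosDef := by
  refine PosDef.posSemidef_add (posSemidef_sum _ fun i _ => ?_) hX
  split_ifs
  · exact (posSemidef_vecMulVec_self_star _).smul (by exact_mod_cast (hp i).le)
  · exact PosSemidef.zero

theorem sum_inv_tailCov_sub [DecidableEq n] (k : ℕ) (hk : k ≤ M) :
    (∑ i : Fin M, if (i : ℕ) < k then
      (tailCov X p u (i + 1))⁻¹ - (tailCov X p u i)⁻¹ else 0) =
      (tailCov X p u k)⁻¹ - (tailCov X p u 0)⁻¹ := by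
  rw [Fin.sum_univ_eq_sum_range (fun i => if i < k then
      (tailCov X p u (i + 1))⁻¹ - (tailCov X p u i)⁻¹ else 0) M, ← Finset.sum_filter]
  have : (Finset.range M).filter (· < k) = Finset.range k := by
    ext j
    simp
    omega
  rw [this, Finset.sum_range_sub (fun i => (tailCov X p u i)⁻¹)]

end TailCov

end Matrix

namespace IFN

variable {L : ℕ} {tx rx : Fin L → ℕ} {N : IFN L tx rx}
  {S : ∀ l, Matrix (Fin (tx l)) (Fin (tx l)) ℂ} {w : Fin L → ℝ}

theorem _root_.StreamDecomposition.t_ne_zero (d : StreamDecomposition S) (l : Fin L)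
    (m : Fin (d.M l)) : d.t l m ≠ 0 := by
  intro h
  have := d.t_unit l m
  rw [h] at this
  simp at this

/-- The quadratic form in the KKT gradient vanishes at every stream. -/
theorem quadRe_stream_eq_zero (d : StreamDecomposition S) (l : Fin L)
    {G : Matrix (Fin (tx l)) (Fin (tx l)) ℂ} (hG : (-G).PosSemidef)
    (h : (S l * G).trace = 0) (m : Fin (d.M l)) : quadRe G (d.t l m) = 0 := by
  have h1 : (S l * G).trace.re = ∑ m, d.p l m * quadRe G (d.t l m) := by
    rw [d.sum_eq l, Matrix.sum_mul, trace_sum, Complex.re_sum]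
    refine Finset.sum_congr rfl fun m _ => ?_
    rw [Matrix.smul_mul, trace_smul, trace_vecMulVec_mul, quadRe]
    simp
  have h2 : ∀ m ∈ Finset.univ, d.p l m * quadRe G (d.t l m) ≤ 0 := fun m _ => by
    have := hG.quadRe_nonneg (d.t l m)
    have e : quadRe (-G) (d.t l m) = -quadRe G (d.t l m) := by
      have := quadRe_sub 0 G (d.t l m)
      rwa [zero_sub, quadRe_zero, zero_sub] at this
    rw [e] at this
    exact mul_nonpos_of_nonneg_of_nonpos (d.p_pos l m).le (by linarith)
  rw [h, Complex.zero_re] at h1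
  have h3 := (Finset.sum_eq_zero_iff_of_nonpos h2).1 h1.symm m (Finset.mem_univ m)
  exact (mul_eq_zero.1 h3).resolve_left (d.p_pos l m).ne'

/-- The signal direction of a stream at its receiver. -/
noncomputable def streamDir (N : IFN L tx rx) (d : StreamDecomposition S) (l : Fin L)
    (m : Fin (d.M l)) : Fin (rx l) → ℂ :=
  N.H l l *ᵥ d.t l m

/-- `uᴴ C⁻¹ u`, for the direction `u` of a stream and its interference-plus-noise covariance `C`. -/
noncomputable def streamGain (N : IFN L tx rx) (d : StreamDecomposition S) (l : Fin L)
    (m : Fin (d.M l)) : ℝ :=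
  quadRe (N.sicCov d l m)⁻¹ (N.streamDir d l m)

/-- The reverse transmit powers at a polite water-filling point. -/
noncomputable def politePower (N : IFN L tx rx) (d : StreamDecomposition S) (w : Fin L → ℝ)
    (a : Σ l : Fin L, Fin (d.M l)) : ℝ :=
  w a.1 * (d.p a.1 a.2 / (1 + d.p a.1 a.2 * N.streamGain d a.1 a.2)) *
    ‖WithLp.toLp 2 (N.mmse d a.1 a.2)‖ ^ 2

section Streams

variable (d : StreamDecomposition S)

theorem mul_vecMulVec_mul_conjTranspose {m n : Type*} [Fintype m] [Fintype n] (H : Matrix m n ℂ)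
    (t : n → ℂ) :
    H * vecMulVec t (star t) * Hᴴ = vecMulVec (H *ᵥ t) (star (H *ᵥ t)) := by
  rw [mul_vecMulVec, vecMulVec_mul, star_mulVec]

/-- The shift by one expresses that stream `m` sees only streams of larger index. Thus the tail at
`m` adds stream `m` itself to its own interference, and the tails run from `totalCov` at `0` to
`Omega` at the number of streams. -/
theorem sicCov_eq_tailCov (l : Fin L) (m : Fin (d.M l)) :
    N.sicCov d l m = tailCov (N.Omega S l) (d.p l) (N.streamDir d l) (m + 1) := by
  rw [tailCov_succ, sicCov]
  simp only [mul_vecMulVec_mul_conjTranspose, streamDir]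

theorem totalCov_eq_tailCov (l : Fin L) :
    N.totalCov S l = tailCov (N.Omega S l) (d.p l) (N.streamDir d l) 0 := by
  rw [tailCov_zero, totalCov, signal, add_comm]
  conv_lhs => rw [d.sum_eq l]
  simp only [Matrix.mul_sum, Matrix.sum_mul, Matrix.mul_smul, Matrix.smul_mul,
    mul_vecMulVec_mul_conjTranspose, streamDir]

variable {d}

theorem sicCov_posDef (hO : ∀ l, (N.Omega S l).PosDef) (l : Fin L) (m : Fin (d.M l)) :
    (N.sicCov d l m).PosDef := by
  rw [sicCov_eq_tailCov]
  exact tailCov_posDef (hO l) (d.p_pos l) _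

theorem mmse_ne_zero (hO : ∀ l, (N.Omega S l).PosDef) {l : Fin L} {m : Fin (d.M l)}
    (hu : N.streamDir d l m ≠ 0) : N.mmse d l m ≠ 0 := by
  intro h
  apply hu
  have := congrArg (N.sicCov d l m *ᵥ ·) h
  simpa [mmse, mulVec_mulVec, mul_nonsing_inv_cancel_left _ _ (sicCov_posDef hO l m).isUnit_det,
    streamDir] using this

theorem norm_mmse_pos (hO : ∀ l, (N.Omega S l).PosDef) {l : Fin L} {m : Fin (d.M l)}
    (hu : N.streamDir d l m ≠ 0) : 0 < ‖WithLp.toLp 2 (N.mmse d l m)‖ := by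
  rw [norm_pos_iff]
  intro h
  exact mmse_ne_zero hO hu (by simpa using h)

theorem streamGain_pos (hO : ∀ l, (N.Omega S l).PosDef) {l : Fin L} {m : Fin (d.M l)}
    (hu : N.streamDir d l m ≠ 0) : 0 < N.streamGain d l m :=
  (sicCov_posDef hO l m).inv.quadRe_pos hu

theorem gain_nonneg (l : Fin L) (m : Fin (d.M l)) (k : Fin L) (n : Fin (d.M k)) :
    0 ≤ N.gain d l m k n := by
  unfold gain
  positivity

theorem gain_eq_quadRe_recv (l : Fin L) (m : Fin (d.M l)) (k : Fin L) (n : Fin (d.M k)) :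
    N.gain d l m k n =
      quadRe (N.H l k * vecMulVec (d.t k n) (star (d.t k n)) * (N.H l k)ᴴ) (N.recv d l m) := by
  rw [mul_vecMulVec_mul_conjTranspose, quadRe_vecMulVec, star_dotProduct_eq_star, norm_star, gain]

theorem gain_eq_quadRe_dir (l : Fin L) (m : Fin (d.M l)) (k : Fin L) (n : Fin (d.M k)) :
    N.gain d l m k n =
      quadRe ((N.H l k)ᴴ * vecMulVec (N.recv d l m) (star (N.recv d l m)) * (N.H l k)ᴴᴴ)
        (d.t k n) := by
  rw [quadRe_congruence, quadRe_vecMulVec, conjTranspose_conjTranspose, gain]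

theorem quadRe_sicCov_mmse (hO : ∀ l, (N.Omega S l).PosDef) (l : Fin L) (m : Fin (d.M l)) :
    quadRe (N.sicCov d l m) (N.mmse d l m) = N.streamGain d l m := by
  have hC := sicCov_posDef (d := d) hO l m
  have h : N.mmse d l m = (N.sicCov d l m)⁻¹ *ᵥ N.streamDir d l m := rfl
  rw [quadRe, h, mulVec_mulVec, mul_nonsing_inv _ hC.isUnit_det, one_mulVec, star_mulVec,
    hC.inv.isHermitian.eq, ← dotProduct_mulVec]
  rfl

theorem quadRe_sicCov_recv (hO : ∀ l, (N.Omega S l).PosDef) (l : Fin L) (m : Fin (d.M l)) :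
    quadRe (N.sicCov d l m) (N.recv d l m) =
      N.streamGain d l m / ‖WithLp.toLp 2 (N.mmse d l m)‖ ^ 2 := by
  rw [recv, ← Complex.ofReal_inv, quadRe_smul_vec, quadRe_sicCov_mmse hO, div_eq_inv_mul, inv_pow]

theorem gain_self (hO : ∀ l, (N.Omega S l).PosDef) (l : Fin L) (m : Fin (d.M l)) :
    N.gain d l m l m = N.streamGain d l m ^ 2 / ‖WithLp.toLp 2 (N.mmse d l m)‖ ^ 2 := by
  have hC := sicCov_posDef (d := d) hO l m
  have h : star (N.mmse d l m) ⬝ᵥ (N.H l l *ᵥ d.t l m) = (N.streamGain d l m : ℂ) := by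
    rw [streamGain, hC.inv.isHermitian.coe_quadRe, mmse, star_mulVec, hC.inv.isHermitian.eq,
      ← dotProduct_mulVec]
    rfl
  rw [gain, recv, star_smul, smul_dotProduct, h, norm_smul, mul_pow, ← Complex.ofReal_inv]
  simp [div_eq_inv_mul]

theorem vecMulVec_recv {l : Fin L} {m : Fin (d.M l)} (hν : 0 < ‖WithLp.toLp 2 (N.mmse d l m)‖) :
    ((‖WithLp.toLp 2 (N.mmse d l m)‖ ^ 2 : ℝ) : ℂ) •
      vecMulVec (N.recv d l m) (star (N.recv d l m)) =
      vecMulVec (N.mmse d l m) (star (N.mmse d l m)) := by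
  have hc : ((‖WithLp.toLp 2 (N.mmse d l m)‖ : ℝ) : ℂ) ≠ 0 := by exact_mod_cast hν.ne'
  rw [recv]
  generalize ‖WithLp.toLp 2 (N.mmse d l m)‖ = c at hc
  ext i j
  simp only [Matrix.smul_apply, vecMulVec_apply, Pi.smul_apply, Pi.star_apply, smul_eq_mul,
    star_mul', star_inv₀, Complex.star_def, Complex.conj_ofReal, Complex.ofReal_pow]
  field_simp

/-- Cross-talk from other links together with the noise makes up `Ω_l`, and cross-talk from later
streams of the same link makes up the remainder of `sicCov`. Since `φ_{l,l} = 0`, no own-link stream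
enters twice. -/
theorem sinr_denominator (hΦd : ∀ l, N.Φ l l = 0) (a : Σ l : Fin L, Fin (d.M l)) :
    (star (N.recv d a.1 a.2) ⬝ᵥ (N.W a.1 *ᵥ N.recv d a.1 a.2)).re +
      ∑ b : Σ l : Fin L, Fin (d.M l), d.p b.1 b.2 * N.Psi d a b =
      quadRe (N.sicCov d a.1 a.2) (N.recv d a.1 a.2) := by
  obtain ⟨l, m⟩ := a
  set r := N.recv d l m with hr
  have h1 : quadRe (N.Omega S l) r = quadRe (N.W l) r +
      ∑ k, ∑ n, d.p k n * (N.Φ l k * N.gain d l m k n) := by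
    rw [Omega, quadRe_add, quadRe_sum]
    congr 1
    refine Finset.sum_congr rfl fun k _ => ?_
    rw [quadRe_smul]
    conv_lhs => rw [d.sum_eq k]
    rw [Matrix.mul_sum, Matrix.sum_mul, quadRe_sum, Finset.mul_sum]
    refine Finset.sum_congr rfl fun n _ => ?_
    rw [Matrix.mul_smul, Matrix.smul_mul, quadRe_smul, gain_eq_quadRe_recv, ← hr]
    ring
  have h2 : quadRe (∑ i ∈ Finset.Ioi m,
      (d.p l i : ℂ) • (N.H l l * vecMulVec (d.t l i) (star (d.t l i)) * (N.H l l)ᴴ)) r =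
      ∑ i, d.p l i * (if (i : ℕ) ≤ (m : ℕ) then 0 else N.gain d l m l i) := by
    rw [quadRe_sum, ← Finset.sum_subset (Finset.subset_univ (Finset.Ioi m))]
    · refine Finset.sum_congr rfl fun i hi => ?_
      have : ¬ (i : ℕ) ≤ (m : ℕ) := not_le.2 (Fin.lt_def.1 (Finset.mem_Ioi.1 hi))
      rw [if_neg this, quadRe_smul, gain_eq_quadRe_recv]
    · intro i _ hi
      have : (i : ℕ) ≤ (m : ℕ) := not_lt.1 fun h => hi (Finset.mem_Ioi.2 h)
      rw [if_pos this, mul_zero]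
  have h3 : ∀ k, ∑ n, d.p k n * N.Psi d ⟨l, m⟩ ⟨k, n⟩ =
      (∑ n, d.p k n * (N.Φ l k * N.gain d l m k n)) +
      if k = l then ∑ i, d.p l i * (if (i : ℕ) ≤ (m : ℕ) then 0 else N.gain d l m l i) else 0 := by
    intro k
    by_cases hk : k = l
    · subst hk
      simp [Psi, hΦd]
    · simp [Psi, hk, Ne.symm hk]
  rw [Fintype.sum_sigma, sicCov, quadRe_add, h1, h2, Finset.sum_congr rfl fun k _ => h3 k,
    Finset.sum_add_distrib, Finset.sum_ite_eq']
  simp only [Finset.mem_univ, if_true, quadRe]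
  ring

/-- Each stream contributes a rank-one term to the polite dual covariance. -/
theorem smul_inv_tailCov_sub (hO : ∀ l, (N.Omega S l).PosDef) {l : Fin L} {m : Fin (d.M l)}
    (hu : N.streamDir d l m ≠ 0) :
    (w l : ℂ) • ((tailCov (N.Omega S l) (d.p l) (N.streamDir d l) (m + 1))⁻¹ -
      (tailCov (N.Omega S l) (d.p l) (N.streamDir d l) m)⁻¹) =
      (N.politePower d w ⟨l, m⟩ : ℂ) • vecMulVec (N.recv d l m) (star (N.recv d l m)) := by
  have h1 := (sicCov_posDef (d := d) hO l m).inv_sub_inv_add_rankOne (N.streamDir d l m)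
    (d.p_pos l m).le
  have h2 : (N.sicCov d l m)⁻¹ *ᵥ N.streamDir d l m = N.mmse d l m := rfl
  rw [tailCov_eq_succ_add, ← sicCov_eq_tailCov, h1, h2, ← vecMulVec_recv (norm_mmse_pos hO hu),
    smul_smul, smul_smul, politePower, streamGain]
  push_cast
  ring_nf

theorem smul_inv_tailCov_sub_totalCov (hO : ∀ l, (N.Omega S l).PosDef)
    (hu : ∀ l m, N.streamDir d l m ≠ 0) (l : Fin L) {k : ℕ} (hk : k ≤ d.M l) :
    (w l : ℂ) • ((tailCov (N.Omega S l) (d.p l) (N.streamDir d l) k)⁻¹ - (N.totalCov S l)⁻¹) =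
      ∑ m : Fin (d.M l), if (m : ℕ) < k then
        (N.politePower d w ⟨l, m⟩ : ℂ) • vecMulVec (N.recv d l m) (star (N.recv d l m)) else 0 := by
  rw [totalCov_eq_tailCov d, ← sum_inv_tailCov_sub k hk, Finset.smul_sum]
  refine Finset.sum_congr rfl fun m _ => ?_
  rw [smul_ite, smul_zero, smul_inv_tailCov_sub hO (hu l m)]

theorem politeDual_eq_sum (hO : ∀ l, (N.Omega S l).PosDef)
    (hu : ∀ l m, N.streamDir d l m ≠ 0) (l : Fin L) :
    N.politeDual S w l = ∑ m : Fin (d.M l),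
      (N.politePower d w ⟨l, m⟩ : ℂ) • vecMulVec (N.recv d l m) (star (N.recv d l m)) := by
  have h := smul_inv_tailCov_sub_totalCov (w := w) hO hu l le_rfl
  rw [tailCov_length] at h
  rw [politeDual, h]
  exact Finset.sum_congr rfl fun m _ => if_pos m.2

/-- For the MMSE receiver the SINR is `p g` with `g = streamGain`, and the gain is `g² / ν²` with
`ν` the norm of the unnormalized receive vector. -/
theorem Dmat_eq_diagonal (hΦd : ∀ l, N.Φ l l = 0) (hO : ∀ l, (N.Omega S l).PosDef)
    (hu : ∀ l m, N.streamDir d l m ≠ 0) :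
    N.Dmat d = diagonal fun a : Σ l : Fin L, Fin (d.M l) =>
      d.p a.1 a.2 * ‖WithLp.toLp 2 (N.mmse d a.1 a.2)‖ ^ 2 / N.streamGain d a.1 a.2 := by
  rw [Dmat]
  congr 1
  funext a
  have hg := streamGain_pos hO (hu a.1 a.2)
  have hν := norm_mmse_pos hO (hu a.1 a.2)
  rw [sinr, sinr_denominator hΦd, quadRe_sicCov_recv hO, gain_self hO]
  field_simp

theorem Dmat_inv_eq_diagonal (hΦd : ∀ l, N.Φ l l = 0) (hO : ∀ l, (N.Omega S l).PosDef)
    (hu : ∀ l m, N.streamDir d l m ≠ 0) :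
    IsUnit (N.Dmat d).det ∧ (N.Dmat d)⁻¹ = diagonal fun a : Σ l : Fin L, Fin (d.M l) =>
      N.streamGain d a.1 a.2 / (d.p a.1 a.2 * ‖WithLp.toLp 2 (N.mmse d a.1 a.2)‖ ^ 2) := by
  have h : N.Dmat d * (diagonal fun a : Σ l : Fin L, Fin (d.M l) =>
      N.streamGain d a.1 a.2 / (d.p a.1 a.2 * ‖WithLp.toLp 2 (N.mmse d a.1 a.2)‖ ^ 2)) = 1 := by
    rw [Dmat_eq_diagonal hΦd hO hu, diagonal_mul_diagonal, ← diagonal_one]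
    congr 1
    funext a
    have hg := streamGain_pos hO (hu a.1 a.2)
    have hν := norm_mmse_pos hO (hu a.1 a.2)
    have hp := d.p_pos a.1 a.2
    field_simp
  exact ⟨isUnit_det_of_right_inverse h, inv_eq_right_inv h⟩

/-- Reverse cross-talk from other links is the interference part of the dual `Ω̂_l`. Within the
link, the streams before `m` contribute a partial telescoping sum of inverse tails, whose upper end
is evaluated by Sherman-Morrison as `g / (1 + p g)`. -/
theorem transpose_Psi_mulVec_politePower (hΦd : ∀ l, N.Φ l l = 0)
    (hO : ∀ l, (N.Omega S l).PosDef) (hu : ∀ l m, N.streamDir d l m ≠ 0)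
    (a : Σ l : Fin L, Fin (d.M l)) :
    ((N.Psi d)ᵀ *ᵥ N.politePower d w) a =
      quadRe (N.dual.Omega (N.politeDual S w) a.1) (d.t a.1 a.2) - N.nhat d a +
      w a.1 * (N.streamGain d a.1 a.2 / (1 + d.p a.1 a.2 * N.streamGain d a.1 a.2) -
        quadRe (N.totalCov S a.1)⁻¹ (N.streamDir d a.1 a.2)) := by
  obtain ⟨l, m⟩ := a
  have h1 : quadRe (N.dual.Omega (N.politeDual S w) l) (d.t l m) = N.nhat d ⟨l, m⟩ +
      ∑ k, ∑ n, N.Φ k l * N.gain d k n l m * N.politePower d w ⟨k, n⟩ := by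
    rw [Omega, quadRe_add, quadRe_sum]
    congr 1
    refine Finset.sum_congr rfl fun k _ => ?_
    rw [quadRe_smul, politeDual_eq_sum hO hu, Matrix.mul_sum, Matrix.sum_mul, quadRe_sum,
      Finset.mul_sum]
    refine Finset.sum_congr rfl fun n _ => ?_
    rw [Matrix.mul_smul, Matrix.smul_mul, quadRe_smul, gain_eq_quadRe_dir]
    simp only [dual, transpose_apply]
    ring
  have h2 : w l * (N.streamGain d l m / (1 + d.p l m * N.streamGain d l m) -
        quadRe (N.totalCov S l)⁻¹ (N.streamDir d l m)) =
      ∑ n : Fin (d.M l), (if (m : ℕ) ≤ (n : ℕ) then 0 else N.gain d l n l m) *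
        N.politePower d w ⟨l, n⟩ := by
    have h := congrArg (fun A => quadRe A (N.streamDir d l m))
      (smul_inv_tailCov_sub_totalCov (w := w) hO hu l m.2.le)
    simp only [quadRe_smul, quadRe_sub, quadRe_sum] at h
    rw [tailCov_eq_succ_add, ← sicCov_eq_tailCov, (sicCov_posDef hO l m).quadRe_inv_add_rankOne _
      (d.p_pos l m).le] at h
    rw [streamGain, h]
    refine Finset.sum_congr rfl fun n _ => ?_
    by_cases hn : (n : ℕ) < m
    · rw [if_pos hn, if_neg (not_le.2 hn), quadRe_smul, quadRe_vecMulVec, gain, mul_comm]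
      rfl
    · rw [if_neg hn, if_pos (not_lt.1 hn), quadRe_zero, zero_mul]
  have h3 : ∀ k, ∑ n, N.Psi d ⟨k, n⟩ ⟨l, m⟩ * N.politePower d w ⟨k, n⟩ =
      (∑ n, N.Φ k l * N.gain d k n l m * N.politePower d w ⟨k, n⟩) +
      if k = l then ∑ n : Fin (d.M l), (if (m : ℕ) ≤ (n : ℕ) then 0 else N.gain d l n l m) *
        N.politePower d w ⟨l, n⟩ else 0 := by
    intro k
    by_cases hk : k = l
    · subst hk
      simp [Psi, hΦd]
    · simp [Psi, hk]
  rw [mulVec, dotProduct, Fintype.sum_sigma]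
  simp only [transpose_apply]
  rw [Finset.sum_congr rfl fun k _ => h3 k, Finset.sum_add_distrib, Finset.sum_ite_eq', h1, h2]
  simp

/-- The term `w g / (1 + p g)` occurs both in `D⁻¹ q` and in `Ψᵀ q` and cancels; the KKT condition
identifies `w uᴴ Z⁻¹ u` with `tᴴ Ω̂ t`, which leaves the reverse noise `n̂`. -/
theorem Dmat_inv_sub_mulVec_politePower (hΦd : ∀ l, N.Φ l l = 0)
    (hO : ∀ l, (N.Omega S l).PosDef) (hu : ∀ l m, N.streamDir d l m ≠ 0)
    (hkkt : ∀ l m, quadRe (N.lagGrad S w l) (d.t l m) = 0) :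
    ((N.Dmat d)⁻¹ - (N.Psi d)ᵀ) *ᵥ N.politePower d w = N.nhat d := by
  funext a
  have h := hkkt a.1 a.2
  have e : quadRe ((N.H a.1 a.1)ᴴ * (N.totalCov S a.1)⁻¹ * N.H a.1 a.1) (d.t a.1 a.2) =
      quadRe (N.totalCov S a.1)⁻¹ (N.streamDir d a.1 a.2) := by
    have := quadRe_congruence (N.H a.1 a.1)ᴴ (N.totalCov S a.1)⁻¹ (d.t a.1 a.2)
    rwa [conjTranspose_conjTranspose] at this
  rw [lagGrad, quadRe_sub, quadRe_smul, e] at h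
  have hg := streamGain_pos hO (hu a.1 a.2)
  have hν := norm_mmse_pos hO (hu a.1 a.2)
  have hp := d.p_pos a.1 a.2
  have h2 : N.streamGain d a.1 a.2 / (d.p a.1 a.2 * ‖WithLp.toLp 2 (N.mmse d a.1 a.2)‖ ^ 2) *
      N.politePower d w a =
      w a.1 * (N.streamGain d a.1 a.2 / (1 + d.p a.1 a.2 * N.streamGain d a.1 a.2)) := by
    rw [politePower]
    field_simp
  rw [sub_mulVec, Pi.sub_apply, (Dmat_inv_eq_diagonal hΦd hO hu).2, mulVec_diagonal, h2,
    transpose_Psi_mulVec_politePower hΦd hO hu]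
  linarith

/-- At a polite water-filling point the covariance transformation is well defined, and it yields
the polite dual covariances whatever the stream decomposition. -/
theorem transformDefined_and_covTransform_eq (hΦ : ∀ l k, 0 ≤ N.Φ l k) (hΦd : ∀ l, N.Φ l l = 0)
    (hWhat : ∀ l, (N.What l).PosDef) (hS : ∀ l, (S l).PosSemidef)
    (hO : ∀ l, (N.Omega S l).PosDef) (hw : ∀ l, 0 ≤ w l)
    (hle : ∀ l, (-N.lagGrad S w l).PosSemidef) (htr : ∀ l, (S l * N.lagGrad S w l).trace = 0)
    (d : StreamDecomposition S) :
    N.TransformDefined d ∧ ∀ l, N.covTransform d l = N.politeDual S w l := by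
  have hkkt : ∀ l m, quadRe (N.lagGrad S w l) (d.t l m) = 0 := fun l m =>
    quadRe_stream_eq_zero d l (hle l) (htr l) m
  have hO' : ∀ l, (N.dual.Omega (N.politeDual S w) l).PosDef :=
    Omega_posDef (N := N.dual) (fun l k => hΦ k l) hWhat (politeDual_posSemidef hS hO hw)
  -- The KKT condition equates this quantity with `tᴴ Ω̂_l t`, and `Ω̂_l` is positive definite. So
  -- every active stream has a nonzero received direction and a positive weight, as the
  -- normalizations require.
  have hpos : ∀ l m, 0 < w l * quadRe (N.totalCov S l)⁻¹ (N.streamDir d l m) := fun l m => by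
    have h := hkkt l m
    have e := quadRe_congruence (N.H l l)ᴴ (N.totalCov S l)⁻¹ (d.t l m)
    rw [conjTranspose_conjTranspose] at e
    rw [lagGrad, quadRe_sub, quadRe_smul, e] at h
    have := (hO' l).quadRe_pos (d.t_ne_zero l m)
    unfold streamDir
    linarith
  have hu : ∀ l m, N.streamDir d l m ≠ 0 := fun l m h0 => by
    have := hpos l m
    rw [h0] at this
    simp [quadRe] at this
  have hwpos : ∀ l, Fin (d.M l) → 0 < w l := fun l m =>
    lt_of_le_of_ne (hw l) fun h0 => by
      have := hpos l m
      rw [← h0, zero_mul] at this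
      exact this.false
  have hq : ∀ a, 0 < N.politePower d w a := fun a => by
    have hg := streamGain_pos hO (hu a.1 a.2)
    have hν := norm_mmse_pos hO (hu a.1 a.2)
    have hp := d.p_pos a.1 a.2
    have := hwpos a.1 a.2
    unfold politePower
    positivity
  have hmul := Dmat_inv_sub_mulVec_politePower hΦd hO hu hkkt
  -- The off-diagonal entries are nonpositive, and the positive vector of polite powers is mapped to
  -- `n̂`, which is positive because the constraint matrices are definite.
  have hunit : IsUnit ((N.Dmat d)⁻¹ - (N.Psi d)ᵀ).det := by
    refine isUnit_iff_ne_zero.2 (det_ne_zero_of_mulVec_pos (fun a b hab => ?_) hq fun a => ?_)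
    · rw [(Dmat_inv_eq_diagonal hΦd hO hu).2, Matrix.sub_apply, diagonal_apply_ne _ hab, zero_sub,
        neg_nonpos, transpose_apply, Psi, of_apply]
      split_ifs
      · exact le_rfl
      · exact gain_nonneg _ _ _ _
      · exact mul_nonneg (hΦ _ _) (gain_nonneg _ _ _ _)
    · rw [hmul]
      exact (hWhat a.1).quadRe_pos (d.t_ne_zero a.1 a.2)
  refine ⟨⟨fun l m => (sicCov_posDef hO l m).isUnit_det, fun l m => mmse_ne_zero hO (hu l m),
    (Dmat_inv_eq_diagonal hΦd hO hu).1, hunit⟩, fun l => ?_⟩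
  have hrev : N.revPower d = N.politePower d w := by
    rw [revPower, ← hmul, mulVec_mulVec, nonsing_inv_mul _ hunit, one_mulVec]
  rw [covTransform, hrev, politeDual_eq_sum hO hu]

end Streams

end IFN

/-- Positive semidefinite covariances have a stream decomposition. -/
theorem nonempty_streamDecomposition {L : ℕ} {tx : Fin L → ℕ}
    {S : ∀ l, Matrix (Fin (tx l)) (Fin (tx l)) ℂ} (hS : ∀ l, (S l).PosSemidef) :
    Nonempty (StreamDecomposition S) := by
  -- Stream powers must be strictly positive, so only eigenvectors with positive eigenvalue are
  -- kept; a zero covariance receives no streams.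
  let I : ∀ l, Type := fun l => {i : Fin (tx l) // 0 < (hS l).1.eigenvalues i}
  let e : ∀ l, Fin (Fintype.card (I l)) ≃ I l := fun l => (Fintype.equivFin (I l)).symm
  refine ⟨⟨fun l => Fintype.card (I l), fun l m => (hS l).1.eigenvalues (e l m),
    fun l m => (hS l).1.eigenvectorBasis (e l m), fun l m => (e l m).2, fun l m => ?_,
    fun l => ?_⟩⟩
  · exact (hS l).1.eigenvectorBasis.norm_eq_one _
  · have h1 : S l = ∑ i, (((hS l).1.eigenvalues i : ℝ) : ℂ) •
        vecMulVec ((hS l).1.eigenvectorBasis i).ofLp (star ((hS l).1.eigenvectorBasis i).ofLp) := by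
      conv_lhs => rw [(hS l).1.spectral_theorem]
      ext a b
      simp [Unitary.conjStarAlgAut_apply, Matrix.mul_apply, Matrix.sum_apply, vecMulVec_apply,
        diagonal_apply, star_apply]
      exact Finset.sum_congr rfl fun i _ => by ring
    rw [Equiv.sum_comp (e l) fun i : I l => (((hS l).1.eigenvalues i : ℝ) : ℂ) •
        vecMulVec ((hS l).1.eigenvectorBasis i).ofLp (star ((hS l).1.eigenvectorBasis i).ofLp)]
    conv_lhs => rw [h1]
    rw [← Finset.sum_subtype (Finset.univ.filter fun i => 0 < (hS l).1.eigenvalues i) (by simp)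
      fun i => (((hS l).1.eigenvalues i : ℝ) : ℂ) •
        vecMulVec ((hS l).1.eigenvectorBasis i).ofLp (star ((hS l).1.eigenvectorBasis i).ofLp)]
    refine (Finset.sum_subset (Finset.filter_subset _ _) fun i _ hi => ?_).symm
    have : (hS l).1.eigenvalues i = 0 :=
      le_antisymm (not_lt.1 (by simpa using hi)) ((hS l).eigenvalues_nonneg i)
    rw [this, Complex.ofReal_zero, zero_smul]

/-! ### KKT conditions of the one-hop dual network. -/

namespace IFN

variable {L : ℕ} {tx rx : Fin L → ℕ} {N : IFN L tx rx}
  {S : ∀ l, Matrix (Fin (tx l)) (Fin (tx l)) ℂ} {w : Fin L → ℝ}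

section Duality

theorem dual_totalCov (T : ∀ l, Matrix (Fin (rx l)) (Fin (rx l)) ℂ) (l : Fin L) :
    N.dual.totalCov T l = N.dual.Omega T l + (N.H l l)ᴴ * T l * N.H l l := by
  simp [totalCov, signal, dual]

variable (hWhat : ∀ l, (N.dual.Omega (N.politeDual S w) l).PosDef)
  (hS : ∀ l, (S l).PosSemidef) (hO : ∀ l, (N.Omega S l).PosDef) (hw : ∀ l, 0 ≤ w l)
  (hle : ∀ l, (-N.lagGrad S w l).PosSemidef) (htr : ∀ l, (S l * N.lagGrad S w l).trace = 0)

include hle in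
theorem Omega_dual_sub_posSemidef (l : Fin L) : (N.dual.Omega (N.politeDual S w) l -
    (w l : ℂ) • ((N.H l l)ᴴ * (N.Omega S l + N.H l l * S l * (N.H l l)ᴴ)⁻¹ *
      N.H l l)).PosSemidef := by
  have := hle l
  rwa [lagGrad, neg_sub] at this

include hWhat hS hO hw hle htr in
theorem dual_politeDual_politeDual (l : Fin L) :
    N.dual.politeDual (N.politeDual S w) w l = S l := by
  rw [politeDual, dual_totalCov]
  exact polite_involutive (hO l) (hWhat l) (hS l) (hw l) rfl (Omega_dual_sub_posSemidef hle l)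
    (htr l)

include hWhat hS hO hw hle htr in
theorem politeDual_mul_mul_inv (l : Fin L) :
    N.politeDual S w l * N.H l l * (N.dual.totalCov (N.politeDual S w) l)⁻¹ =
      (N.totalCov S l)⁻¹ * N.H l l * S l := by
  rw [dual_totalCov]
  exact polite_mul_mul_inv (hO l) (hWhat l) (hS l) (hw l) rfl (Omega_dual_sub_posSemidef hle l)
    (htr l)

include hWhat hS hO hw hle htr in
/-- The KKT conditions carry over to the dual network. -/
theorem dual_lagGrad (l : Fin L) :
    (-N.dual.lagGrad (N.politeDual S w) w l).PosSemidef ∧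
      (N.politeDual S w l * N.dual.lagGrad (N.politeDual S w) w l).trace = 0 := by
  have e : N.dual.lagGrad (N.politeDual S w) w l = (w l : ℂ) • (N.H l l *
      (N.dual.Omega (N.politeDual S w) l + (N.H l l)ᴴ * N.politeDual S w l * N.H l l)⁻¹ *
      (N.H l l)ᴴ) - N.Omega S l := by
    have : N.dual.politeDual (N.politeDual S w) w = S :=
      funext (dual_politeDual_politeDual hWhat hS hO hw hle htr)
    rw [lagGrad, dual_totalCov, dual_dual, this]
    simp only [dual, conjTranspose_conjTranspose]
  rw [e, neg_sub]
  refine ⟨polite_reverse_le (hO l) (hWhat l) (hS l) (hw l) rfl (Omega_dual_sub_posSemidef hle l)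
    (htr l), ?_⟩
  exact (congrArg trace (polite_reverse_mul_eq_zero (hO l) (hWhat l) (hS l) (hw l) rfl
    (Omega_dual_sub_posSemidef hle l) (htr l))).trans (trace_zero _ _)

end Duality

end IFN

/-! ## Relay networks -/

namespace RelayNetwork

variable (N : RelayNetwork)

@[simp] theorem adj_adj (F : N.Precoder) : N.adj (N.adj F) = F := by
  funext q
  simp [adj]

/-- The two adjoints cancel, so both networks use the same products `B F`; all relay structure is
thereby absorbed into one-hop duality. -/
theorem dualIfn_adj (F : N.Precoder) : N.dualIfn (N.adj F) = (N.ifn F).dual := by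
  simp only [dualIfn, IFN.dual, ifn, Bhat, adj_adj, IFN.mk.injEq, true_and]
  refine ⟨?_, ?_, ?_⟩
  · funext l k
    simp [chan, conjTranspose_mul, Matrix.mul_assoc]
  · funext l
    rw [cost, add_comm]
  · funext l
    rfl

/-- The part of the Lagrangian that depends on the precoders only: power of the forwarded relay
noise, weighted with the constraint matrices. -/
noncomputable def relayNoiseCost (F : N.Precoder) : ℝ :=
  ∑ q, ∑ q' ∈ Finset.Iic q, (N.B F q' q * N.W q' * (N.B F q' q)ᴴ * N.What q).trace.re

/-- By cyclicity of the trace, the relay power caused by source `l` is a linear cost on `Σ_l`,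
already contained in `cost`; only forwarded relay noise remains. -/
theorem lagrangian_eq (w : Fin N.L → ℝ) (S : N.SrcCov) (F : N.Precoder) :
    N.lagrangian w S F = (N.ifn F).lag S w - N.relayNoiseCost F := by
  have h1 : ∀ q, (N.relayCov S F q * N.What q).trace.re =
      (∑ l, (S l * ((N.H0 l)ᴴ * (N.B F 0 q)ᴴ * N.What q * N.B F 0 q * N.H0 l)).trace.re) +
      ∑ q' ∈ Finset.Iic q, (N.B F q' q * N.W q' * (N.B F q' q)ᴴ * N.What q).trace.re := by
    intro q
    rw [relayCov, Matrix.add_mul, Matrix.sum_mul, Matrix.sum_mul, trace_add, trace_sum, trace_sum,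
      Complex.add_re, Complex.re_sum, Complex.re_sum]
    congr 1
    refine Finset.sum_congr rfl fun l _ => ?_
    congr 1
    simp only [Matrix.mul_assoc]
    rw [← Matrix.mul_assoc (N.B F 0 q), Matrix.trace_mul_comm]
    simp only [Matrix.mul_assoc]
  have h2 : ∀ l, (S l * N.cost F l).trace.re =
      (∑ q, (S l * ((N.H0 l)ᴴ * (N.B F 0 q)ᴴ * N.What q * N.B F 0 q * N.H0 l)).trace.re) +
      (S l * N.Wsrc l).trace.re := by
    intro l
    rw [cost, Matrix.mul_add, Matrix.mul_sum, trace_add, trace_sum, Complex.add_re, Complex.re_sum]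
  rw [lagrangian, IFN.lag, relayNoiseCost, Finset.sum_congr rfl fun q _ => h1 q,
    Finset.sum_add_distrib, Finset.sum_comm]
  change _ = _ - ∑ l, (S l * N.cost F l).trace.re - _
  rw [Finset.sum_congr rfl fun l _ => h2 l, Finset.sum_add_distrib]
  ring

/-- The leftover is the same as for the original network: noise born at `q` and penalized at `q' ≥
q` contributes one trace, and the dual merely sums these in the other order. -/
theorem dualLagrangian_adj_eq (w : Fin N.L → ℝ) (Sh : N.DstCov) (F : N.Precoder) :
    N.dualLagrangian w Sh (N.adj F) = (N.ifn F).dual.lag Sh w - N.relayNoiseCost F := by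
  have h1 : ∀ q, (N.dualRelayCov Sh (N.adj F) q * N.W q).trace.re =
      (∑ l, (Sh l * (N.HQ l * N.B F q (Fin.last N.n) * N.W q * (N.B F q (Fin.last N.n))ᴴ *
        (N.HQ l)ᴴ)).trace.re) +
      ∑ q' ∈ Finset.Ici q, (N.B F q q' * N.W q * (N.B F q q')ᴴ * N.What q').trace.re := by
    intro q
    rw [dualRelayCov, Matrix.add_mul, Matrix.sum_mul, Matrix.sum_mul, trace_add, trace_sum,
      trace_sum, Complex.add_re, Complex.re_sum, Complex.re_sum]
    simp only [Bhat, adj_adj]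
    congr 1
    · refine Finset.sum_congr rfl fun l _ => ?_
      congr 1
      simp only [Matrix.mul_assoc]
      rw [← Matrix.mul_assoc (N.B F q (Fin.last N.n))ᴴ, Matrix.trace_mul_comm]
      simp only [Matrix.mul_assoc]
    · refine Finset.sum_congr rfl fun q' _ => ?_
      congr 1
      simp only [Matrix.mul_assoc]
      rw [← Matrix.mul_assoc (N.B F q q')ᴴ, Matrix.trace_mul_comm]
      simp only [Matrix.mul_assoc]
  have h2 : ∀ l, (Sh l * N.noise F l).trace.re =
      (∑ q, (Sh l * (N.HQ l * N.B F q (Fin.last N.n) * N.W q * (N.B F q (Fin.last N.n))ᴴ *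
        (N.HQ l)ᴴ)).trace.re) + (Sh l * N.Wdst l).trace.re := by
    intro l
    rw [noise, Matrix.mul_add, Matrix.mul_sum, trace_add, trace_sum, Complex.add_re,
      Complex.re_sum]
  have h3 : N.relayNoiseCost F =
      ∑ q, ∑ q' ∈ Finset.Ici q, (N.B F q q' * N.W q * (N.B F q q')ᴴ * N.What q').trace.re := by
    rw [relayNoiseCost]
    exact Finset.sum_comm' fun q q' => by simp
  rw [dualLagrangian, dualIfn_adj, IFN.lag, h3, Finset.sum_congr rfl fun q _ => h1 q,
    Finset.sum_add_distrib, Finset.sum_comm]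
  change _ = _ - ∑ l, (Sh l * N.noise F l).trace.re - _
  rw [Finset.sum_congr rfl fun l _ => h2 l, Finset.sum_add_distrib]
  ring

theorem composite_typeIPrec (Fh : N.RelayPrecoder) :
    N.composite (N.typeIPrec Fh) = N.adj (N.composite Fh) := by
  funext q
  exact (blockDiagonal'_conjTranspose (Fh q)).symm

theorem composite_update (F : N.RelayPrecoder) (q : Fin (N.n + 1)) (j : Fin (N.relays q))
    (X : Matrix (Fin (N.ant q j)) (Fin (N.ant q j)) ℂ) :
    N.composite (Function.update F q (Function.update (F q) j X)) =
      Function.update (N.composite F) q (blockDiagonal' (Function.update (F q) j X)) := by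
  funext q'
  by_cases h : q' = q
  · subst h
    simp [composite]
  · simp [composite, h]

theorem adj_update (F : N.Precoder) (q : Fin (N.n + 1)) (X : Matrix (N.Cl q) (N.Cl q) ℂ) :
    N.adj (Function.update F q X) = Function.update (N.adj F) q Xᴴ := by
  funext q'
  by_cases h : q' = q
  · subst h
    simp [adj]
  · simp [adj, h]

variable {N}

theorem noise_posDef (F : N.Precoder) (l : Fin N.L) : (N.noise F l).PosDef := by
  refine PosDef.posSemidef_add (posSemidef_sum _ fun q _ => ?_) (N.Wdst_pd l)
  have := (N.W_psd q).mul_mul_conjTranspose_same (N.HQ l * N.B F q (Fin.last N.n))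
  rwa [conjTranspose_mul, ← Matrix.mul_assoc] at this

theorem cost_posSemidef (F : N.Precoder) (l : Fin N.L) : (N.cost F l).PosSemidef := by
  refine (posSemidef_sum _ fun q _ => ?_).add (N.Wsrc_psd l)
  have := (N.What_psd q).conjTranspose_mul_mul_same (N.B F 0 q * N.H0 l)
  rwa [conjTranspose_mul, ← Matrix.mul_assoc] at this

theorem Φ_nonneg (l k : Fin N.L) : 0 ≤ N.Φ l k := by
  rcases N.Φ_binary l k with h | h <;> rw [h]
  exact zero_le_one

/-! ### Smooth dependence on the precoders and restriction to single relays. -/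

section Calculus

attribute [local instance] Matrix.supNormedAddCommGroup Matrix.supNormedSpace

theorem differentiableAt_B (F : N.Precoder) (q q' : Fin (N.n + 1)) :
    DifferentiableAt ℝ (fun F => N.B F q q') F := by
  have hF : ∀ i, DifferentiableAt ℝ (fun F : N.Precoder => F i) F := fun i =>
    differentiableAt_apply i F
  induction q' using Fin.induction with
  | zero => exact (hF 0).matrix_mul (differentiableAt_const _)
  | succ i ih =>
    exact (hF i.succ).matrix_mul
      (((differentiableAt_const (N.H i)).matrix_mul ih).const_add (N.idAt q i.succ))

theorem differentiableAt_chan (F : N.Precoder) (l k : Fin N.L) :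
    DifferentiableAt ℝ (fun F => N.chan F l k) F :=
  ((differentiableAt_const _).matrix_mul (differentiableAt_B F _ _)).matrix_mul
    (differentiableAt_const _)

theorem differentiableAt_noise (F : N.Precoder) (l : Fin N.L) :
    DifferentiableAt ℝ (fun F => N.noise F l) F := by
  refine (DifferentiableAt.fun_sum fun q _ => ?_).add_const _
  have hB := differentiableAt_B F q (Fin.last N.n)
  exact ((((differentiableAt_const _).matrix_mul hB).matrix_mul
    (differentiableAt_const _)).matrix_mul hB.matrix_conjTranspose).matrix_mul
      (differentiableAt_const _)

theorem differentiableAt_cost (F : N.Precoder) (l : Fin N.L) :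
    DifferentiableAt ℝ (fun F => N.cost F l) F := by
  refine (DifferentiableAt.fun_sum fun q _ => ?_).add_const _
  have hB := differentiableAt_B F 0 q
  exact ((((differentiableAt_const _).matrix_mul hB.matrix_conjTranspose).matrix_mul
    (differentiableAt_const _)).matrix_mul hB).matrix_mul (differentiableAt_const _)

theorem differentiableAt_relayNoiseCost (F : N.Precoder) :
    DifferentiableAt ℝ N.relayNoiseCost F := by
  refine DifferentiableAt.fun_sum fun q _ => DifferentiableAt.fun_sum fun q' _ => ?_
  have hB := differentiableAt_B F q' q
  have h := ((hB.matrix_mul (differentiableAt_const (N.W q'))).matrix_mul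
    hB.matrix_conjTranspose).matInner_comp (N.What q)
  simpa only [matInner_eq_of_isHermitian (N.What_psd q).isHermitian,
    Matrix.trace_mul_comm (N.What q)] using h

/-- Embedding of the precoders of a single relay into those of its cluster. -/
noncomputable def relayBlock (q : Fin (N.n + 1)) (j : Fin (N.relays q)) :
    Matrix (Fin (N.ant q j)) (Fin (N.ant q j)) ℂ →L[ℝ] Matrix (N.Cl q) (N.Cl q) ℂ :=
  LinearMap.toContinuousLinearMap
    { toFun := fun X => blockDiagonal' (Pi.single j X)
      map_add' := fun X Y => by rw [Pi.single_add, blockDiagonal'_add]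
      map_smul' := fun c X => by rw [Pi.single_smul, blockDiagonal'_smul]; rfl }

theorem relayBlock_conjTranspose (q : Fin (N.n + 1)) (j : Fin (N.relays q))
    (X : Matrix (Fin (N.ant q j)) (Fin (N.ant q j)) ℂ) :
    (relayBlock q j X)ᴴ = relayBlock (N := N) q j Xᴴ := by
  change (blockDiagonal'
    (Pi.single j X : ∀ j, Matrix (Fin (N.ant q j)) (Fin (N.ant q j)) ℂ))ᴴ =
    blockDiagonal' (Pi.single j Xᴴ : ∀ j, Matrix (Fin (N.ant q j)) (Fin (N.ant q j)) ℂ)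
  rw [blockDiagonal'_conjTranspose]
  congr 1
  funext i
  by_cases h : i = j
  · subst h
    simp
  · simp [h]

/-- The composite precoder is affine in one relay block with linear part `relayBlock`, so the relay
gradient is the full gradient tested on that block. -/
theorem hasFDerivAt_relay {f : N.Precoder → ℝ} {F : N.RelayPrecoder} {q : Fin (N.n + 1)}
    {G : Matrix (N.Cl q) (N.Cl q) ℂ}
    (h : HasMatGrad (fun X => f (Function.update (N.composite F) q X)) (N.composite F q) G)
    (j : Fin (N.relays q)) :
    HasFDerivAt (fun X => f (N.composite (Function.update F q (Function.update (F q) j X))))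
      ((matInner G).comp (relayBlock q j)) (F q j) := by
  have e : ∀ X, blockDiagonal' (Function.update (F q) j X) =
      relayBlock q j X + blockDiagonal' (Function.update (F q) j 0) := by
    intro X
    change _ = blockDiagonal'
      (Pi.single j X : ∀ j, Matrix (Fin (N.ant q j)) (Fin (N.ant q j)) ℂ) + _
    rw [← blockDiagonal'_add]
    congr 1
    funext i
    by_cases h : i = j
    · subst h
      simp
    · simp [h]
  have h1 : HasFDerivAt (fun X => blockDiagonal' (Function.update (F q) j X))
      (relayBlock q j) (F q j) := by
    rw [funext e]
    exact (relayBlock q j).hasFDerivAt.add_const _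
  simp only [composite_update]
  have h2 : blockDiagonal' (Function.update (F q) j (F q j)) = N.composite F q := by
    rw [Function.update_eq_self]; rfl
  exact HasFDerivAt.comp (F q j) (g := fun X => f (Function.update (N.composite F) q X))
    (by rw [h2]; exact h) h1

end Calculus

end RelayNetwork

/-! ### Gradients with respect to full precoder matrices. -/

section PrecoderGradients

attribute [local instance] Matrix.supNormedAddCommGroup Matrix.supNormedSpace

theorem matInner_conjTranspose_left {m n : Type*} [Fintype m] [Fintype n] (K : Matrix m n ℂ)
    (D : Matrix n m ℂ) : matInner Kᴴ D = matInner K Dᴴ := by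
  rw [← matInner_conjTranspose K, conjTranspose_conjTranspose]

/-- Two functions of the precoders whose difference has vanishing derivative have the same
gradients, up to conjugate transposition of the argument. -/
theorem RelayNetwork.exists_gradients {N : RelayNetwork} {f h : N.Precoder → ℝ} {F : N.Precoder}
    (hf : DifferentiableAt ℝ f F) (hfh : HasFDerivAt (fun y => f y - h (N.adj y))
      (0 : N.Precoder →L[ℝ] ℝ) F) (q : Fin (N.n + 1)) :
    ∃ G : Matrix (N.Cl q) (N.Cl q) ℂ,
      HasMatGrad (fun X => h (Function.update (N.adj F) q X)) (N.adj F q) G ∧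
      HasMatGrad (fun X => f (Function.update F q X)) (F q) Gᴴ := by
  have hu := hasFDerivAt_update (𝕜 := ℝ) F (i := q) (F q)
  obtain ⟨K, hK⟩ := exists_eq_matInner ((fderiv ℝ f F).comp
    (ContinuousLinearMap.pi (Pi.single q (ContinuousLinearMap.id ℝ (Matrix (N.Cl q) (N.Cl q) ℂ)))))
  have h1 : HasFDerivAt (fun X => f (Function.update F q X)) (matInner K) (F q) := by
    rw [← hK]
    exact HasFDerivAt.comp (F q) (by rw [Function.update_eq_self]; exact hf.hasFDerivAt) hu
  have h2 : HasFDerivAt (fun X => h (N.adj (Function.update F q X))) (matInner K) (F q) := by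
    have h3 : HasFDerivAt (fun X => f (Function.update F q X) - h (N.adj (Function.update F q X)))
        ((0 : N.Precoder →L[ℝ] ℝ).comp (ContinuousLinearMap.pi (Pi.single q
          (ContinuousLinearMap.id ℝ (Matrix (N.Cl q) (N.Cl q) ℂ))))) (F q) :=
      HasFDerivAt.comp (F q) (g := fun y => f y - h (N.adj y))
        (by rw [Function.update_eq_self]; exact hfh) hu
    refine ((h1.sub h3).congr_fderiv (by simp)).congr_of_eventuallyEq
      (Filter.Eventually.of_forall fun X => ?_)
    simp
  -- `K` is the gradient of `f`; substituting the conjugate transpose of the variable, a real-linear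
  -- isometry for the trace inner product, turns it into `Kᴴ`.
  refine ⟨Kᴴ, ?_, by rw [conjTranspose_conjTranspose]; exact h1⟩
  have h4 : HasFDerivAt (fun X => h (N.adj (Function.update F q Xᴴ)))
      ((matInner K).comp Matrix.conjTransposeCLM) (N.adj F q) :=
    HasFDerivAt.comp (N.adj F q) (g := fun X => h (N.adj (Function.update F q X)))
      (f := Matrix.conjTransposeCLM)
      (by rw [Matrix.conjTransposeCLM_apply, RelayNetwork.adj, conjTranspose_conjTranspose]
          exact h2) Matrix.conjTransposeCLM.hasFDerivAt
  have h5 : (fun X => h (N.adj (Function.update F q Xᴴ))) =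
      fun X => h (Function.update (N.adj F) q X) := by
    funext X
    rw [N.adj_update, conjTranspose_conjTranspose]
  rw [h5] at h4
  refine h4.congr_fderiv ?_
  ext D
  exact (matInner_conjTranspose_left K D).symm

end PrecoderGradients

/-! ### Transfer of stationarity from the dual network. -/

namespace RelayNetwork

variable {N : RelayNetwork}

section Duality

attribute [local instance] Matrix.supNormedAddCommGroup Matrix.supNormedSpace

/-- A stationary point of the dual network satisfies the KKT conditions of the one-hop network with
the gradients of the one-hop Lagrangian. -/
theorem IsDualStationary.lagGrad {w : Fin N.L → ℝ} {Sh : N.DstCov} {F : N.Precoder}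
    {Fh : N.RelayPrecoder} (hF : N.composite Fh = N.adj F) (hw : ∀ l, 0 ≤ w l)
    (hO : ∀ l, ((N.ifn F).dual.Omega Sh l).PosDef) (h : N.IsDualStationary w Sh Fh) (l : Fin N.L) :
    (-(N.ifn F).dual.lagGrad Sh w l).PosSemidef ∧
      (Sh l * (N.ifn F).dual.lagGrad Sh w l).trace = 0 := by
  obtain ⟨-, hS, hcov, -⟩ := h
  obtain ⟨G, hG, hle, htr⟩ := hcov l
  have hW : ∀ l, ((N.ifn F).dual.What l).IsHermitian := fun l => (noise_posDef F l).isHermitian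
  have hder : HasFDerivAt (fun X => N.dualLagrangian w (Function.update Sh l X) (N.composite Fh))
      (matInner ((N.ifn F).dual.lagGrad Sh w l)) (Sh l) := by
    simp only [hF, dualLagrangian_adj_eq]
    exact (IFN.hasFDerivAt_lag hS hO hW l).sub_const _
  -- The gradient in the stationarity condition is only known to exist; uniqueness identifies it
  -- with the explicit one.
  have e := hG.eq_of_hasFDerivAt (hS l).isHermitian
    (IFN.lagGrad_isHermitian hS hO hw (fun l => (noise_posDef F l).isHermitian) l) hder
  rw [← e]
  exact ⟨hle, htr⟩

/-- The Type I dual transformation maps stationary points of the dual network to stationary points,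
and the gradients with respect to the precoders correspond. -/
theorem IsDualStationary.typeI_dual {w : Fin N.L → ℝ} (hw : ∀ l, 0 ≤ w l) {Sh : N.DstCov}
    {Fh : N.RelayPrecoder} (hstat : N.IsDualStationary w Sh Fh) :
    Nonempty (StreamDecomposition Sh) ∧
    ∀ d : StreamDecomposition Sh,
      (N.dualIfn (N.composite Fh)).TransformDefined d ∧
      N.IsStationary w (N.typeICov Fh d) (N.typeIPrec Fh) ∧
      ∀ q, ∃ G : Matrix (N.Cl q) (N.Cl q) ℂ,
        HasMatGrad (fun X => N.dualLagrangian w Sh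
          (Function.update (N.composite Fh) q X)) (N.composite Fh q) G ∧
        HasMatGrad (fun X => N.lagrangian w (N.typeICov Fh d)
          (Function.update (N.composite (N.typeIPrec Fh)) q X))
          (N.composite (N.typeIPrec Fh) q) Gᴴ := by

  obtain ⟨F, hF⟩ : ∃ F, F = N.composite (N.typeIPrec Fh) := ⟨_, rfl⟩
  have hFh : N.composite Fh = N.adj F := by
    rw [hF, N.composite_typeIPrec, N.adj_adj]
  have hM : N.dualIfn (N.composite Fh) = (N.ifn F).dual := by rw [hFh, N.dualIfn_adj]
  obtain ⟨hunit, hS, hcov, hrelay⟩ := id hstat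
  have hΦ : ∀ l k, 0 ≤ (N.ifn F).dual.Φ l k := fun l k => Φ_nonneg k l
  -- The source matrices are only semidefinite, so definiteness of `Ω̂_l` needs the nonsingularity
  -- contained in dual stationarity. In the other direction it is automatic, since the destination
  -- noise is definite.
  have hO : ∀ l, ((N.ifn F).dual.Omega Sh l).PosDef := fun l =>
    (IFN.Omega_posSemidef hΦ (cost_posSemidef F) hS l).posDef_of_isUnit_det
      (by rw [← hM]; exact hunit l)
  have hle := fun l => (hstat.lagGrad hFh hw hO l).1
  have htr := fun l => (hstat.lagGrad hFh hw hO l).2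
  refine ⟨nonempty_streamDecomposition hS, fun d => ?_⟩
  obtain ⟨hdef, hT⟩ := IFN.transformDefined_and_covTransform_eq hΦ N.Φ_diag
    (noise_posDef F) hS hO hw hle htr d
  have hcovT : N.typeICov Fh d = (N.ifn F).dual.politeDual Sh w := by
    rw [typeICov, hM]
    exact funext hT
  have hTpos : ∀ l, (N.typeICov Fh d l).PosSemidef := fun l => by
    rw [hcovT]
    exact IFN.politeDual_posSemidef hS hO hw l
  have hO' : ∀ l, ((N.ifn F).Omega (N.typeICov Fh d) l).PosDef :=
    IFN.Omega_posDef (N := N.ifn F) (fun l k => Φ_nonneg l k)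
      (noise_posDef F) hTpos
  have hO'' : ∀ l, ((N.ifn F).dual.dual.Omega ((N.ifn F).dual.politeDual Sh w) l).PosDef := by
    rw [← hcovT, IFN.dual_dual]
    exact hO'
  -- The one-hop theory is applied with the dual network as the starting point, so its dual is the
  -- original network.
  have hgrad := IFN.dual_lagGrad hO'' hS hO hw hle htr
  have hinv := IFN.dual_politeDual_politeDual hO'' hS hO hw hle htr
  have hmul := IFN.politeDual_mul_mul_inv hO'' hS hO hw hle htr
  rw [← hcovT, IFN.dual_dual] at hgrad hinv hmul
  have hzero := IFN.hasFDerivAt_lag_sub_dual (w := w) (𝒩 := N.ifn) (Φ := N.Φ) (fun _ => rfl)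
    (differentiableAt_chan F) (differentiableAt_noise F)
    (differentiableAt_cost F) hTpos hS hO' hO hinv
    (fun l => (congrFun hcovT l).symm) hmul
  have hdiff : DifferentiableAt ℝ (N.lagrangian w (N.typeICov Fh d)) F := by
    have h := (IFN.differentiableAt_lag (w := w) (𝒩 := N.ifn) (Φ := N.Φ) (fun _ => rfl)
      (differentiableAt_chan F) (differentiableAt_noise F)
      (differentiableAt_cost F) hTpos hO').sub
      (differentiableAt_relayNoiseCost F)
    exact h.congr_of_eventuallyEq (Filter.Eventually.of_forall (N.lagrangian_eq w _))
  -- The common relay noise term drops out of the difference of the two Lagrangians.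
  have hfull := exists_gradients (h := N.dualLagrangian w Sh) hdiff (by
    simpa only [N.lagrangian_eq, N.dualLagrangian_adj_eq, sub_sub_sub_cancel_right] using hzero)
  rw [← hFh] at hfull
  rw [← hF]
  refine ⟨by rw [hM]; exact hdef, ⟨fun l => ?_, hTpos, fun l => ?_, fun q j => ?_⟩, hfull⟩
  · rw [← hF]
    exact (hO' l).isUnit_det
  · refine ⟨(N.ifn F).lagGrad (N.typeICov Fh d) w l, ⟨IFN.lagGrad_isHermitian hTpos hO' hw
      (fun l => (cost_posSemidef F l).isHermitian) l, ?_⟩, hgrad l⟩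
    rw [← hF]
    simp only [N.lagrangian_eq]
    exact ((IFN.hasFDerivAt_lag hTpos hO'
      (fun l => (cost_posSemidef F l).isHermitian) l).sub_const _).hasFDerivWithinAt
  -- Dual stationarity says that `G` annihilates every diagonal block direction. These directions
  -- are closed under conjugate transposition, so `Gᴴ` annihilates them too.
  · obtain ⟨G, hG, hG'⟩ := hfull q
    have h1 := hasFDerivAt_relay (f := N.dualLagrangian w Sh) hG j
    rw [hF] at hG'
    have h2 := hasFDerivAt_relay (f := N.lagrangian w (N.typeICov Fh d)) hG' j
    have h3 := h1.unique (hrelay q j)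
    refine h2.congr_fderiv ?_
    ext D
    have h4 := congrArg (fun φ => φ Dᴴ) h3
    simp only [ContinuousLinearMap.comp_apply] at h4
    rw [ContinuousLinearMap.comp_apply, matInner_conjTranspose_left,
      relayBlock_conjTranspose, h4]
    simp [matInner_apply]

end Duality

end RelayNetwork

theorem mainTheorem7 (N : RelayNetwork) (w : Fin N.L → ℝ) (hw : ∀ l, 0 ≤ w l)
    (Sh : N.DstCov) (Fh : N.RelayPrecoder) (hstat : N.IsDualStationary w Sh Fh) :
    Nonempty (StreamDecomposition Sh) ∧
    ∀ d : StreamDecomposition Sh,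
      (N.dualIfn (N.composite Fh)).TransformDefined d ∧
      N.IsStationary w (N.typeICov Fh d) (N.typeIPrec Fh) ∧
      ∀ q, ∃ G : Matrix (N.Cl q) (N.Cl q) ℂ,
        HasMatGrad (fun X => N.dualLagrangian w Sh
          (Function.update (N.composite Fh) q X)) (N.composite Fh q) G ∧
        HasMatGrad (fun X => N.lagrangian w (N.typeICov Fh d)
          (Function.update (N.composite (N.typeIPrec Fh)) q X))
          (N.composite (N.typeIPrec Fh) q) Gᴴ :=
  hstat.typeI_dual hw
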